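/- Let $F$ be a non-archimedean local field or a finite field (with the discrete topology), put $G_m=GL_m(F)$, and fix a non-trivial locally constant additive character $\psi_0$ of $F$. Let $P=\left\{\begin{pmatrix} g_1&x\\0&g_2\end{pmatrix}\right\}$ ($g_1,g_2\in G_n$, $x\in M_n(F)$) be the standard parabolic subgroup of $G_{2n}$ of type $(n,n)$, with modular character $\delta_P$ and unipotent radical $N=\left\{\begin{pmatrix} I_n&x\\0&I_n\end{pmatrix}\right\}$, and let $\psi$ be the character of $N$ given by $\psi\begin{pmatrix} I_n&x\\0&I_n\end{pmatrix}=\psi_0(\operatorname{tr} x)$. For smooth complex representations $\rho_1,\rho_2$ of $G_n$, let $\rho_1\times\rho_2=\operatorname{ind}_P^{G_{2n}}\bigl(\delta_P^{1/2}(\rho_1\otimes\rho_2)\bigr)$ be the normalized parabolically induced representation, where $\begin{pmatrix} g_1&x\\0&g_2\end{pmatrix}$ acts through $\rho_1(g_1)\otimes\rho_2(g_2)$. For a smooth representation $(\pi,V)$ of $G_{2n}$, let $\pi_{N,\psi}$ be the quotient of $V$ by the span of all $\pi(u)v-\psi(u)v$ ($u\in N$, $v\in V$); it is a representation of $\Delta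 G_n=\left\{\begin{pmatrix} g&0\\0&g\end{pmatrix}:g\in G_n\right\}\cong G_n$. Theorem. For all smooth complex representations $\rho_1,\rho_2$ of $G_n$ there is an injective $G_n$-equivariant linear map $\rho_1\otimes\rho_2\hookrightarrow(\rho_1\times\rho_2)_{N,\psi}$, where $g\in G_n$ acts on $\rho_1\otimes\rho_2$ by $\rho_1(g)\otimes\rho_2(g)$ and on $(\rho_1\times\rho_2)_{N,\psi}$ through $\Delta G_n$. Consequently, if $\rho_1$ and $\rho_2$ are non-zero, then $(\rho_1\times\rho_2)_{N,\psi}$ is non-zero. -/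

import Mathlib

open scoped TensorProduct

/-- `F` is a finite field (with the discrete topology) or a non-archimedean local field (with its
valuation topology). -/
class IsFiniteOrLocalField (F : Type*) [Field F] [TopologicalSpace F] : Prop where
  out : (Finite F ∧ DiscreteTopology F) ∨
    ∃ _ : ValuativeRel F, IsNonarchimedeanLocalField F

namespace IsFiniteOrLocalField

variable (F : Type*) [Field F] [TopologicalSpace F] [h : IsFiniteOrLocalField F]

instance : IsTopologicalRing F := by
  rcases h.out with ⟨_, _⟩ | ⟨_, _⟩ <;> infer_instance

instance : T2Space F := by
  rcases h.out with ⟨_, _⟩ | ⟨_, _⟩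
  · infer_instance
  · letI := IsTopologicalAddGroup.rightUniformSpace F
    have := isUniformAddGroup_of_addCommGroup (G := F)
    infer_instance

instance : LocallyCompactSpace F := by
  rcases h.out with ⟨_, _⟩ | ⟨_, _⟩ <;> infer_instance

end IsFiniteOrLocalField

/-! ### Smooth representations and compact induction -/

section General

variable {G : Type*} [Group G] [TopologicalSpace G]
variable {W : Type*} [AddCommGroup W] [Module ℂ W]

/-- A complex representation of a topological group is smooth if the stabilizer of every vector
is open. -/
def IsSmoothRep (π : Representation ℂ G W) : Prop :=
  ∀ v : W, IsOpen {g : G | π g v = v}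

variable [IsTopologicalGroup G]

/-- The space of the unnormalized compactly induced representation `ind_H^G(σ)`: the functions
`f : G → W` with `f (h g) = σ(h) f(g)` that are right invariant under some open subgroup (in an
`ℓ`-group: equivalently, under some compact open subgroup) and whose support is contained in
`H C` for some compact set `C`. -/
def compactIndSpace (H : Subgroup G) (σ : Representation ℂ H W) : Submodule ℂ (G → W) where
  carrier := {f | (∀ (h : H) (g : G), f (h * g) = σ h (f g)) ∧
    (∃ K : OpenSubgroup G, ∀ (g : G), ∀ k ∈ K, f (g * k) = f g) ∧
    (∃ C : Set G, IsCompact C ∧ ∀ g : G, f g ≠ 0 → ∃ h : H, ∃ c ∈ C, g = h * c)}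
  zero_mem' := by
    refine ⟨fun h g => by simp, ⟨⊤, fun g k _ => rfl⟩, ⟨∅, isCompact_empty, fun g hg => ?_⟩⟩
    exact absurd rfl hg
  add_mem' := by
    rintro f₁ f₂ ⟨h₁, ⟨K₁, hK₁⟩, ⟨C₁, hC₁, hs₁⟩⟩ ⟨h₂, ⟨K₂, hK₂⟩, ⟨C₂, hC₂, hs₂⟩⟩
    refine ⟨fun h g => by simp [h₁, h₂], ⟨K₁ ⊓ K₂, fun g k hk => ?_⟩,
      ⟨C₁ ∪ C₂, hC₁.union hC₂, fun g hg => ?_⟩⟩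
    · obtain ⟨hk1, hk2⟩ := OpenSubgroup.mem_inf.mp hk
      simp [hK₁ g k hk1, hK₂ g k hk2]
    · by_cases h0 : f₁ g = 0
      · have h0' : f₂ g ≠ 0 := fun h => hg (by simp [h0, h])
        obtain ⟨h, c, hc, e⟩ := hs₂ g h0'
        exact ⟨h, c, Or.inr hc, e⟩
      · obtain ⟨h, c, hc, e⟩ := hs₁ g h0
        exact ⟨h, c, Or.inl hc, e⟩
  smul_mem' := by
    rintro a f ⟨h₁, ⟨K₁, hK₁⟩, ⟨C₁, hC₁, hs₁⟩⟩
    refine ⟨fun h g => by simp [h₁], ⟨K₁, fun g k hk => by simp [hK₁ g k hk]⟩,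
      ⟨C₁, hC₁, fun g hg => hs₁ g fun h => hg (by simp [h])⟩⟩

/-- The unnormalized compactly induced representation `ind_H^G(σ)`: `G` acts by right
translation, `(x • f)(g) = f (g x)`. -/
def compactInd (H : Subgroup G) (σ : Representation ℂ H W) :
    Representation ℂ G (compactIndSpace H σ) where
  toFun x :=
    (LinearMap.funLeft ℂ W (fun g : G => g * x)).restrict (by
      rintro f ⟨h₁, ⟨K, hK⟩, ⟨C, hC, hs⟩⟩
      refine ⟨fun h g => ?_, ⟨K.comap (MulAut.conj x⁻¹).toMonoidHom ?_, fun g k hk => ?_⟩,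
        ⟨(fun g => g * x⁻¹) '' C, hC.image (by fun_prop), fun g hg => ?_⟩⟩
      · simp only [LinearMap.funLeft_apply, mul_assoc, h₁]
      · change Continuous fun k : G => x⁻¹ * k * x⁻¹⁻¹
        fun_prop
      · have hk' : x⁻¹ * k * x ∈ K := by simpa using OpenSubgroup.mem_comap.mp hk
        have := hK (g * x) _ hk'
        simp only [LinearMap.funLeft_apply]
        rw [← this]
        congr 1
        group
      · obtain ⟨h, c, hc, e⟩ := hs (g * x) hg
        exact ⟨h, c * x⁻¹, ⟨c, hc, rfl⟩, by rw [← mul_assoc, ← e, mul_inv_cancel_right]⟩)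
  map_one' := by
    ext f g
    simp [LinearMap.restrict_apply, LinearMap.funLeft_apply]
  map_mul' x y := by
    ext f g
    simp [LinearMap.restrict_apply, LinearMap.funLeft_apply, mul_assoc]

end General

/-! ### Twisted Jacquet modules -/

section TwistedJacquet

variable {G : Type*} [Group G] {V : Type*} [AddCommGroup V] [Module ℂ V]

/-- The subspace `V(U, θ)` of `V` spanned by the vectors `π(u) v - θ(u) v`. -/
def twistedKernel (π : Representation ℂ G V) (U : Subgroup G) (θ : U →* ℂ) : Submodule ℂ V :=
  Submodule.span ℂ {w | ∃ (u : U) (v : V), w = π u v - θ u • v}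

/-- The image of `j : L → G` normalizes `U` and fixes the character `θ` of `U`. -/
def NormalizesChar {L : Type*} [Group L] (j : L →* G) (U : Subgroup G) (θ : U →* ℂ) : Prop :=
  ∀ (l : L) (u : U), ∃ h : j l * u * (j l)⁻¹ ∈ U, θ ⟨j l * u * (j l)⁻¹, h⟩ = θ u

/-- The (unnormalized) twisted Jacquet module `π_{U,θ}`: the action of `L` on `V / V(U, θ)`
induced by `π`, for a group `L` mapping to the stabilizer of `(U, θ)` in `G`. -/
def twistedJacquet (π : Representation ℂ G V) (U : Subgroup G) (θ : U →* ℂ)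
    {L : Type*} [Group L] (j : L →* G) (hj : NormalizesChar j U θ) :
    Representation ℂ L (V ⧸ twistedKernel π U θ) where
  toFun l := (twistedKernel π U θ).mapQ (twistedKernel π U θ) (π (j l)) (by
    rw [twistedKernel, Submodule.span_le]
    rintro w ⟨u, v, rfl⟩
    obtain ⟨h, hθ⟩ := hj l u
    refine Submodule.subset_span ⟨⟨_, h⟩, π (j l) v, ?_⟩
    rw [hθ, map_sub, map_smul]
    simp [map_mul])
  map_one' := by
    ext v
    simp
  map_mul' l m := by
    ext v
    simp

end TwistedJacquet

/-! ### The groups `G_n`, `P`, `N` and the character `ψ`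

`G_{m+n}` is realized as the group of invertible matrices with rows and columns indexed by
`Fin m ⊕ Fin n`, i.e. as invertible block matrices. -/

section Blocks

variable {F : Type*} [Field F]

lemma toBlocks₂₁_inv_eq_zero {m n : ℕ} (g : GL (Fin m ⊕ Fin n) F)
    (hg : g.val.toBlocks₂₁ = 0) : (g⁻¹).val.toBlocks₂₁ = 0 := by
  have h : g.val * (g⁻¹).val = 1 := by rw [← Units.val_mul, mul_inv_cancel, Units.val_one]
  rw [← Matrix.fromBlocks_toBlocks g.val, ← Matrix.fromBlocks_toBlocks (g⁻¹).val,
    Matrix.fromBlocks_multiply, ← Matrix.fromBlocks_one, Matrix.fromBlocks_inj, hg] at h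
  obtain ⟨-, -, h1, h2⟩ := h
  rw [Matrix.zero_mul, zero_add] at h1 h2
  have h3 := mul_eq_one_comm.mp h2
  calc (g⁻¹).val.toBlocks₂₁
      = ((g⁻¹).val.toBlocks₂₂ * g.val.toBlocks₂₂) * (g⁻¹).val.toBlocks₂₁ := by
        rw [h3, Matrix.one_mul]
    _ = 0 := by rw [Matrix.mul_assoc, h1, Matrix.mul_zero]

lemma val_mul_eq_fromBlocks {m n : ℕ} (p q : GL (Fin m ⊕ Fin n) F) :
    (p * q).val = Matrix.fromBlocks
      (p.val.toBlocks₁₁ * q.val.toBlocks₁₁ + p.val.toBlocks₁₂ * q.val.toBlocks₂₁)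
      (p.val.toBlocks₁₁ * q.val.toBlocks₁₂ + p.val.toBlocks₁₂ * q.val.toBlocks₂₂)
      (p.val.toBlocks₂₁ * q.val.toBlocks₁₁ + p.val.toBlocks₂₂ * q.val.toBlocks₂₁)
      (p.val.toBlocks₂₁ * q.val.toBlocks₁₂ + p.val.toBlocks₂₂ * q.val.toBlocks₂₂) := by
  rw [← Matrix.fromBlocks_multiply, Matrix.fromBlocks_toBlocks, Matrix.fromBlocks_toBlocks,
    Units.val_mul]

variable (F)

/-- The maximal standard parabolic subgroup `P_{m,n}` of `G_{m+n}`: the invertible block upper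
triangular matrices. -/
def stdParabolic (m n : ℕ) : Subgroup (GL (Fin m ⊕ Fin n) F) where
  carrier := {g | g.val.toBlocks₂₁ = 0}
  one_mem' := by
    change (1 : Matrix (Fin m ⊕ Fin n) (Fin m ⊕ Fin n) F).toBlocks₂₁ = 0
    rw [← Matrix.fromBlocks_one, Matrix.toBlocks_fromBlocks₂₁]
  mul_mem' := by
    intro a b ha hb
    change (a * b).val.toBlocks₂₁ = 0
    change a.val.toBlocks₂₁ = 0 at ha
    change b.val.toBlocks₂₁ = 0 at hb
    rw [val_mul_eq_fromBlocks, Matrix.toBlocks_fromBlocks₂₁, ha, hb]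
    simp
  inv_mem' := by
    intro a ha
    exact toBlocks₂₁_inv_eq_zero a ha

variable {F}

lemma toBlocks₁₁_mul_of_mem {m n : ℕ} (p q : stdParabolic F m n) :
    (p * q).val.val.toBlocks₁₁ = p.val.val.toBlocks₁₁ * q.val.val.toBlocks₁₁ := by
  have hq : q.val.val.toBlocks₂₁ = 0 := q.2
  rw [Subgroup.coe_mul, val_mul_eq_fromBlocks, Matrix.toBlocks_fromBlocks₁₁, hq]
  simp

lemma toBlocks₂₂_mul_of_mem {m n : ℕ} (p q : stdParabolic F m n) :
    (p * q).val.val.toBlocks₂₂ = p.val.val.toBlocks₂₂ * q.val.val.toBlocks₂₂ := by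
  have hp : p.val.val.toBlocks₂₁ = 0 := p.2
  rw [Subgroup.coe_mul, val_mul_eq_fromBlocks, Matrix.toBlocks_fromBlocks₂₂, hp]
  simp

lemma toBlocks₁₁_one_parabolic {m n : ℕ} :
    (1 : stdParabolic F m n).val.val.toBlocks₁₁ = 1 := by
  change (1 : Matrix (Fin m ⊕ Fin n) (Fin m ⊕ Fin n) F).toBlocks₁₁ = 1
  rw [← Matrix.fromBlocks_one, Matrix.toBlocks_fromBlocks₁₁]

lemma toBlocks₂₂_one_parabolic {m n : ℕ} :
    (1 : stdParabolic F m n).val.val.toBlocks₂₂ = 1 := by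
  change (1 : Matrix (Fin m ⊕ Fin n) (Fin m ⊕ Fin n) F).toBlocks₂₂ = 1
  rw [← Matrix.fromBlocks_one, Matrix.toBlocks_fromBlocks₂₂]

/-- The projection of the block matrix `(g₁ x; 0 g₂)` in `P_{m,n}` to `g₁`. -/
def leviFst (m n : ℕ) : stdParabolic F m n →* GL (Fin m) F where
  toFun p :=
    { val := p.val.val.toBlocks₁₁
      inv := (p⁻¹).val.val.toBlocks₁₁
      val_inv := by rw [← toBlocks₁₁_mul_of_mem, mul_inv_cancel, toBlocks₁₁_one_parabolic]
      inv_val := by rw [← toBlocks₁₁_mul_of_mem, inv_mul_cancel, toBlocks₁₁_one_parabolic] }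
  map_one' := Units.ext toBlocks₁₁_one_parabolic
  map_mul' p q := Units.ext (toBlocks₁₁_mul_of_mem p q)

/-- The projection of the block matrix `(g₁ x; 0 g₂)` in `P_{m,n}` to `g₂`. -/
def leviSnd (m n : ℕ) : stdParabolic F m n →* GL (Fin n) F where
  toFun p :=
    { val := p.val.val.toBlocks₂₂
      inv := (p⁻¹).val.val.toBlocks₂₂
      val_inv := by rw [← toBlocks₂₂_mul_of_mem, mul_inv_cancel, toBlocks₂₂_one_parabolic]
      inv_val := by rw [← toBlocks₂₂_mul_of_mem, inv_mul_cancel, toBlocks₂₂_one_parabolic] }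
  map_one' := Units.ext toBlocks₂₂_one_parabolic
  map_mul' p q := Units.ext (toBlocks₂₂_mul_of_mem p q)

variable (F)

/-- The unipotent radical `N` of `P = P_{n,n}`: the block matrices `(1 x; 0 1)`. -/
def unipRadical (n : ℕ) : Subgroup (GL (Fin n ⊕ Fin n) F) where
  carrier := {g | ∃ x : Matrix (Fin n) (Fin n) F, g.val = Matrix.fromBlocks 1 x 0 1}
  one_mem' := ⟨0, by rw [Units.val_one, Matrix.fromBlocks_one]⟩
  mul_mem' := by
    rintro a b ⟨x, hx⟩ ⟨y, hy⟩
    exact ⟨y + x, by rw [Units.val_mul, hx, hy, Matrix.fromBlocks_multiply]; simp⟩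
  inv_mem' := by
    rintro a ⟨x, hx⟩
    refine ⟨-x, Units.inv_eq_of_mul_eq_one_right ?_⟩
    rw [hx, Matrix.fromBlocks_multiply, ← Matrix.fromBlocks_one]
    simp

variable {F}

/-- The character `ψ` of `N`: it sends `(1 x; 0 1)` to `ψ₀(tr x)`. -/
def unipChar (n : ℕ) (ψ₀ : AddChar F ℂ) : unipRadical F n →* ℂ where
  toFun u := ψ₀ u.val.val.toBlocks₁₂.trace
  map_one' := by
    have h : (1 : unipRadical F n).val.val.toBlocks₁₂ = 0 := by
      change (1 : Matrix (Fin n ⊕ Fin n) (Fin n ⊕ Fin n) F).toBlocks₁₂ = 0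
      rw [← Matrix.fromBlocks_one, Matrix.toBlocks_fromBlocks₁₂]
    rw [h, Matrix.trace_zero, AddChar.map_zero_eq_one]
  map_mul' u v := by
    obtain ⟨x, hx⟩ := u.2
    obtain ⟨y, hy⟩ := v.2
    have h : (u * v).val.val = Matrix.fromBlocks 1 (y + x) 0 1 := by
      rw [Subgroup.coe_mul, Units.val_mul, hx, hy, Matrix.fromBlocks_multiply]
      simp
    rw [h, hx, hy]
    simp only [Matrix.toBlocks_fromBlocks₁₂, Matrix.trace_add, AddChar.map_add_eq_mul]
    exact mul_comm _ _

variable (F)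

/-- The diagonal embedding `Δ : G_n → G_{2n}`, `g ↦ (g 0; 0 g)`. -/
def diagEmb (n : ℕ) : GL (Fin n) F →* GL (Fin n ⊕ Fin n) F where
  toFun g :=
    { val := Matrix.fromBlocks g.val 0 0 g.val
      inv := Matrix.fromBlocks (g⁻¹).val 0 0 (g⁻¹).val
      val_inv := by
        rw [Matrix.fromBlocks_multiply, ← Units.val_mul, mul_inv_cancel]; simp
      inv_val := by
        rw [Matrix.fromBlocks_multiply, ← Units.val_mul, inv_mul_cancel]; simp }
  map_one' := Units.ext (by simp)
  map_mul' g h := Units.ext (by simp [Matrix.fromBlocks_multiply])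

variable {F}

/-- The group `ΔG_n` normalizes `N` and stabilizes `ψ`. -/
theorem diagEmb_normalizes (n : ℕ) (ψ₀ : AddChar F ℂ) :
    NormalizesChar (diagEmb F n) (unipRadical F n) (unipChar n ψ₀) := by
  intro g u
  obtain ⟨x, hx⟩ := u.2
  have key : (diagEmb F n g * u.val * (diagEmb F n g)⁻¹).val =
      Matrix.fromBlocks 1 (g.val * x * (g⁻¹).val) 0 1 := by
    rw [← map_inv, Units.val_mul, Units.val_mul, hx]
    change Matrix.fromBlocks g.val 0 0 g.val * _ *
      Matrix.fromBlocks (g⁻¹).val 0 0 (g⁻¹).val = _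
    rw [Matrix.fromBlocks_multiply, Matrix.fromBlocks_multiply]
    have h1 : g.val * (g⁻¹).val = 1 := by rw [← Units.val_mul, mul_inv_cancel, Units.val_one]
    simp only [Matrix.mul_one, Matrix.mul_zero, Matrix.zero_mul, add_zero, zero_add, h1]
  refine ⟨⟨_, key⟩, ?_⟩
  change ψ₀ (diagEmb F n g * u.val * (diagEmb F n g)⁻¹).val.toBlocks₁₂.trace =
    ψ₀ u.val.val.toBlocks₁₂.trace
  rw [key, hx, Matrix.toBlocks_fromBlocks₁₂, Matrix.toBlocks_fromBlocks₁₂, Matrix.trace_mul_comm,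
    ← Matrix.mul_assoc, ← Units.val_mul, inv_mul_cancel, Units.val_one, Matrix.one_mul]

end Blocks

/-! ### Normalized parabolic induction -/

section Product

variable {F : Type*} [Field F] [TopologicalSpace F] [IsFiniteOrLocalField F]

instance instLocallyCompactSpaceStdParabolic (m n : ℕ) :
    LocallyCompactSpace (stdParabolic F m n) := by
  have hM : LocallyCompactSpace (Matrix (Fin m ⊕ Fin n) (Fin m ⊕ Fin n) F) :=
    inferInstanceAs (LocallyCompactSpace ((Fin m ⊕ Fin n) → (Fin m ⊕ Fin n) → F))
  have hG : LocallyCompactSpace (GL (Fin m ⊕ Fin n) F) := inferInstance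
  have hc : IsClosed ((stdParabolic F m n : Subgroup (GL (Fin m ⊕ Fin n) F)) :
      Set (GL (Fin m ⊕ Fin n) F)) := by
    change IsClosed {g : GL (Fin m ⊕ Fin n) F | g.val.toBlocks₂₁ = 0}
    refine isClosed_eq ?_ continuous_const
    refine continuous_matrix fun i j => ?_
    exact Units.continuous_val.matrix_elem (Sum.inr i) (Sum.inl j)
  exact hc.isClosedEmbedding_subtypeVal.locallyCompactSpace

variable {m n : ℕ} {V₁ V₂ : Type*} [AddCommGroup V₁] [Module ℂ V₁] [AddCommGroup V₂] [Module ℂ V₂]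

/-- The representation `δ_P^{1/2} (ρ₁ ⊗ ρ₂)` of `P = P_{m,n}`, where `δ_P` is the modular
character of `P` and `ρ₁ ⊗ ρ₂` is inflated from the Levi subgroup `G_m × G_n` to `P`. -/
noncomputable def normalizedInflation (ρ₁ : Representation ℂ (GL (Fin m) F) V₁)
    (ρ₂ : Representation ℂ (GL (Fin n) F) V₂) :
    Representation ℂ (stdParabolic F m n) (V₁ ⊗[ℂ] V₂) where
  toFun p := ((Real.sqrt (MeasureTheory.Measure.modularCharacter p : ℝ) : ℝ) : ℂ) •
    TensorProduct.map (ρ₁ (leviFst m n p)) (ρ₂ (leviSnd m n p))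
  map_one' := by
    simp only [map_one, NNReal.coe_one, Real.sqrt_one, Complex.ofReal_one, one_smul,
      TensorProduct.map_one]
  map_mul' p q := by
    simp only [map_mul, NNReal.coe_mul, Real.sqrt_mul (NNReal.coe_nonneg _),
      Complex.ofReal_mul, TensorProduct.map_mul, smul_mul_smul_comm]

/-- The product `ρ₁ × ρ₂`: the normalized parabolically induced representation
`ind_P^G(δ_P^{1/2} (ρ₁ ⊗ ρ₂))` of `G = G_{m+n}`, with `P = P_{m,n}`. -/
noncomputable def bzProduct (ρ₁ : Representation ℂ (GL (Fin m) F) V₁)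
    (ρ₂ : Representation ℂ (GL (Fin n) F) V₂) :
    Representation ℂ (GL (Fin m ⊕ Fin n) F)
      (compactIndSpace (stdParabolic F m n) (normalizedInflation ρ₁ ρ₂)) :=
  compactInd (stdParabolic F m n) (normalizedInflation ρ₁ ρ₂)

/-- The twisted Jacquet module `(ρ₁ × ρ₂)_{N,ψ}`, as a representation of `G_n ≅ ΔG_n`. -/
noncomputable def bzProductTwistedJacquet (ψ₀ : AddChar F ℂ)
    (ρ₁ : Representation ℂ (GL (Fin n) F) V₁) (ρ₂ : Representation ℂ (GL (Fin n) F) V₂) :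
    Representation ℂ (GL (Fin n) F)
      (compactIndSpace (stdParabolic F n n) (normalizedInflation ρ₁ ρ₂) ⧸
        twistedKernel (bzProduct ρ₁ ρ₂) (unipRadical F n) (unipChar n ψ₀)) :=
  twistedJacquet (bzProduct ρ₁ ρ₂) (unipRadical F n) (unipChar n ψ₀) (diagEmb F n)
    (diagEmb_normalizes n ψ₀)

end Product

section

open Filter Topology MeasureTheory MeasureTheory.Measure

/-! ### Compact open subrings of finite and local fields -/

section LocalField

variable (F : Type*) [Field F] [TopologicalSpace F] [h : IsFiniteOrLocalField F]

/-! Let `w` be the block swap and identify `N` with `M_n(F)`. In the open cell `P w N` the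
factorization `p w u` is unique (`openCell_unique`). Fix a compact open subgroup `K` of `M_n(F)` on
which `ψ₀ ∘ tr` is trivial. A vector `v` of the inducing representation `σ` gives the function
`cellFun σ K v`, supported on `P w K` and equal to `σ(p) v` at `p w u`. It lies in the induced space
(`cellFun_mem`), and the required map sends `v` to its class in the twisted Jacquet module.

Injectivity comes from the functionals `f ↦ ∫_B ψ(-x) ℓ(f(w x)) dx`, with `ℓ` a linear form. The
integral over all of `N` may diverge, since `f` need not be supported in the cell, so it is
truncated to compact subgroups `B`. Each element of `V(N, ψ)` is killed once `B` is large enough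
(`exists_setIntegral_eq_zero_of_mem_twistedKernel`), whereas `cellFun σ K v` yields `vol(K) ℓ(v)` as
soon as `B` contains `K`. Hence a vector with zero class is killed by every `ℓ`
(`injective_mkQ_cellMap`).

For equivariance, `Δ(g)` carries the function of `(K, v)` to that of `(g K g⁻¹, σ(Δ(g)) v)`
(`compactInd_diagEmb_cellMap`). Shrinking `K` to an open subgroup `L` only divides the class by the
index `[K : L]` (`mkQ_cellMap_of_le`), so comparing `K` and `g K g⁻¹` with their intersection gives
equivariance up to a positive scalar `cellFactor K g`. Neither the modular character nor the indices
have to be computed. By injectivity the scalar is multiplicative in `g`, and it is `1` on scalar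
matrices. A homomorphism from `GL_n(F)` to a torsion-free abelian group that is trivial on scalars
is trivial (`GL_hom_eq_one_of_scalar`), so the scalar is always `1`. -/

instance IsFiniteOrLocalField.isTopologicalDivisionRing : IsTopologicalDivisionRing F := by
  rcases h.out with ⟨_, _⟩ | ⟨_, _⟩
  · exact { continuousAt_inv₀ := fun x _ => continuous_of_discreteTopology.continuousAt }
  · infer_instance

/-- A finite or local field has a compact open subring. -/
lemma IsFiniteOrLocalField.exists_isCompact_isOpen_subring :
    ∃ O : Subring F, IsCompact (O : Set F) ∧ IsOpen (O : Set F) := by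
  rcases h.out with ⟨_, _⟩ | ⟨_, _⟩
  · exact ⟨⊤, (Set.toFinite _).isCompact, isOpen_discrete _⟩
  · refine ⟨(ValuativeRel.valuation F).integer,
      IsNonarchimedeanLocalField.isCompact_closedBall F 1, ?_⟩
    let := IsTopologicalAddGroup.rightUniformSpace F
    have := isUniformAddGroup_of_addCommGroup (G := F)
    exact Valued.isOpen_integer F

end LocalField

/-! ### Elements on which the modular character is trivial -/

section ModularCharacter

open MeasureTheory Measure

variable {G : Type*} [TopologicalSpace G] [Group G] [IsTopologicalGroup G] [LocallyCompactSpace G]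

/-- Right translation by a central element is also left translation, which preserves Haar measure.
-/
lemma modularCharacter_eq_one_of_mem_center {g : G} (hg : g ∈ Subgroup.center G) :
    modularCharacter g = 1 := by
  borelize G
  change modularCharacterFun g = 1
  rw [modularCharacterFun_eq_haarScalarFactor haar g]
  have : map (· * g) (haar : Measure G) = haar := by
    have hg' : (fun x : G => x * g) = fun x => g * x :=
      funext fun x => Subgroup.mem_center_iff.mp hg x
    rw [hg', map_mul_left_eq_self]
  simp only [this, haarScalarFactor_self]

/-- Right translation by `g` maps `H` to itself, and `H` has finite positive Haar measure, so the
scaling factor is `1`. This makes the modular character trivial near the identity, as smoothness of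
the inducing representation requires. -/
lemma modularCharacter_eq_one_of_mem_isCompact_isOpen {H : Subgroup G}
    (hc : IsCompact (H : Set G)) (ho : IsOpen (H : Set G)) {g : G} (hg : g ∈ H) :
    modularCharacter g = 1 := by
  borelize G
  change modularCharacterFun g = 1
  rw [modularCharacterFun_eq_haarScalarFactor haar g]
  have hcl : IsClosed (H : Set G) := Subgroup.isClosed_of_isOpen H ho
  have key := measure_isMulInvariant_eq_smul_of_isCompact_closure
    (map (· * g) (haar : Measure G)) haar (s := (H : Set G)) (by rwa [hcl.closure_eq])
  rw [map_apply (measurable_mul_const g) ho.measurableSet] at key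
  have : (fun x : G => x * g) ⁻¹' (H : Set G) = H := by
    ext x
    exact Subgroup.mul_mem_cancel_right H hg
  rw [this] at key
  have h0 : (haar : Measure G) (H : Set G) ≠ 0 := (ho.measure_pos haar ⟨1, H.one_mem⟩).ne'
  have ht : (haar : Measure G) (H : Set G) ≠ ⊤ := hc.measure_ne_top
  rw [ENNReal.smul_def, smul_eq_mul] at key
  nth_rw 1 [← one_mul ((haar : Measure G) (H : Set G))] at key
  exact_mod_cast ((ENNReal.mul_left_inj h0 ht).mp key).symm

end ModularCharacter

/-! ### Homomorphisms from the general linear group to torsion-free abelian groups -/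

section GLCharacter

open Matrix

variable {F : Type*} [Field F] {n : ℕ}

/-- The diagonal matrices in `GL n F`. -/
def diagGL (n : ℕ) (F : Type*) [Field F] : (Fin n → Fˣ) →* GL (Fin n) F :=
  (Units.map (Matrix.diagonalRingHom (Fin n) F : (Fin n → F) →* Matrix (Fin n) (Fin n) F)).comp
    (MulEquiv.piUnits (M := fun _ : Fin n => F)).symm.toMonoidHom

lemma diagGL_val (d : Fin n → Fˣ) :
    (diagGL n F d).val = Matrix.diagonal fun i => (d i : F) := rfl

/-- A permutation matrix in `GL n F`. -/
def permGL (F : Type*) [Field F] (s : Equiv.Perm (Fin n)) : GL (Fin n) F where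
  val := s.permMatrix F
  inv := s⁻¹.permMatrix F
  val_inv := by rw [← Matrix.permMatrix_mul]; simp
  inv_val := by rw [← Matrix.permMatrix_mul]; simp

/-- A transvection in `GL n F`. -/
def transvectionGL (i j : Fin n) (hij : i ≠ j) (a : F) : GL (Fin n) F where
  val := transvection i j a
  inv := transvection i j (-a)
  val_inv := by rw [transvection_mul_transvection_same _ _ hij]; simp
  inv_val := by rw [transvection_mul_transvection_same _ _ hij]; simp

lemma permGL_mul_diagGL (s : Equiv.Perm (Fin n)) (d : Fin n → Fˣ) :
    permGL F s * diagGL n F d = diagGL n F (d ∘ s) * permGL F s := by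
  ext i j
  simp only [Units.val_mul, diagGL_val, permGL, Matrix.mul_diagonal, Matrix.diagonal_mul,
    Equiv.Perm.permMatrix, PEquiv.toMatrix_apply, Function.comp]
  by_cases hs : s i = j <;> simp [hs]

/-- Conjugation by the diagonal matrix with `2` in place `i` doubles the off-diagonal entry, and so
does squaring. Any homomorphism to an abelian group therefore kills the transvection. -/
lemma isConj_sq_transvectionGL (h2 : (2 : F) ≠ 0) (i j : Fin n) (hij : i ≠ j) (a : F) :
    diagGL n F (Function.update 1 i (Units.mk0 2 h2)) * transvectionGL i j hij a =
      (transvectionGL i j hij a) ^ 2 * diagGL n F (Function.update 1 i (Units.mk0 2 h2)) := by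
  ext k l
  rw [sq]
  simp only [Units.val_mul, diagGL_val, transvectionGL]
  rw [transvection_mul_transvection_same _ _ hij, Matrix.mul_diagonal, Matrix.diagonal_mul]
  simp only [transvection, Matrix.add_apply, Matrix.one_apply, Matrix.single_apply,
    Function.update_apply, Pi.one_apply]
  by_cases hk : k = i <;> by_cases hl : l = j <;> by_cases hkl : k = l <;>
    grind [Units.val_mk0, Units.val_one]

/-- A homomorphism from `GL n F` to a commutative group without elements of finite order, as the
positive reals, is trivial if it is trivial on the scalar matrices. -/
lemma GL_hom_eq_one_of_scalar {M : Type*} [CommGroup M]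
    (hM : ∀ (x : M) (k : ℕ), k ≠ 0 → x ^ k = 1 → x = 1) (χ : GL (Fin n) F →* M)
    (hχ : ∀ a : Fˣ, χ (diagGL n F fun _ => a) = 1) : χ = 1 := by
  have hdiag (d : Fin n → Fˣ) : χ (diagGL n F d) = 1 := by
    -- All permutations of `d` have the same image under `χ`, and their product is a scalar matrix.
    -- So `χ` of the diagonal matrix has `n!`-th power `1`.
    refine hM _ (Fintype.card (Equiv.Perm (Fin n))) Fintype.card_ne_zero ?_
    have hperm (s : Equiv.Perm (Fin n)) : χ (diagGL n F (d ∘ s)) = χ (diagGL n F d) := by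
      have := congrArg χ (permGL_mul_diagGL s d)
      rw [map_mul, map_mul, mul_comm] at this
      exact (mul_right_cancel this).symm
    have hprod : ∏ s : Equiv.Perm (Fin n), χ (diagGL n F (d ∘ s)) =
        χ (diagGL n F d) ^ Fintype.card (Equiv.Perm (Fin n)) := by
      simp [hperm]
    rw [← hprod]
    change ∏ s : Equiv.Perm (Fin n), (χ.comp (diagGL n F)) (d ∘ s) = 1
    rw [← map_prod, MonoidHom.comp_apply]
    rcases n with _ | n
    · rw [← hχ 1]
      congr 2
      exact Subsingleton.elim _ _
    · rw [← hχ (∏ s : Equiv.Perm (Fin (n + 1)), d (s 0))]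
      congr 2
      funext i
      rw [Finset.prod_apply]
      -- The product of `d (s i)` over all `s` does not depend on `i`: replacing `s` by `s * swap 0
      -- i` moves `i` to `0`.
      refine Fintype.prod_equiv (Equiv.mulRight (Equiv.swap 0 i)) _ _ fun s => ?_
      simp
  have htrans (i j : Fin n) (hij : i ≠ j) (a : F) : χ (transvectionGL i j hij a) = 1 := by
    by_cases h2 : (2 : F) = 0
    -- In characteristic two a transvection squares to the identity, so its image is torsion.
    · refine hM _ 2 two_ne_zero ?_
      rw [← map_pow, ← map_one χ]
      congr 1
      apply Units.ext
      rw [sq, Units.val_mul]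
      simp only [transvectionGL]
      rw [transvection_mul_transvection_same _ _ hij, ← two_mul, h2, zero_mul, transvection_zero,
        Units.val_one]
    · have := congrArg χ (isConj_sq_transvectionGL h2 i j hij a)
      rw [map_mul, map_mul, hdiag, one_mul, mul_one, map_pow, sq] at this
      exact mul_eq_left.mp this.symm
  ext g
  suffices H : ∀ g' : GL (Fin n) F, g'.val = g.val → χ g' = 1 from H g rfl
  refine diagonal_transvection_induction_of_det_ne_zero
    (fun M => ∀ g' : GL (Fin n) F, g'.val = M → χ g' = 1) g.val
    ((Matrix.isUnit_iff_isUnit_det _).mp g.isUnit).ne_zero ?_ ?_ ?_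
  · intro D hD g' hg'
    rw [det_diagonal, Finset.prod_ne_zero_iff] at hD
    rw [← hdiag fun i => Units.mk0 (D i) (hD i (Finset.mem_univ i))]
    congr 1
    apply Units.ext
    rw [hg', diagGL_val]
    rfl
  · intro t g' hg'
    rw [← htrans t.i t.j t.hij t.c]
    congr 1
    exact Units.ext hg'
  · intro A B hA hB hPA hPB g' hg'
    have : g' = GeneralLinearGroup.mkOfDetNeZero A hA * GeneralLinearGroup.mkOfDetNeZero B hB :=
      Units.ext hg'
    rw [this, map_mul, hPA _ rfl, hPB _ rfl, one_mul]

end GLCharacter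

/-! ### Smoothness of the inducing representation -/

lemma IsSmoothRep.eventually {G : Type*} [Group G] [TopologicalSpace G] {W : Type*}
    [AddCommGroup W] [Module ℂ W] {π : Representation ℂ G W} (h : IsSmoothRep π) (v : W) :
    ∀ᶠ g in 𝓝 (1 : G), π g v = v :=
  (h v).mem_nhds (by simp)

/-- The stabilizer of a vector is a subgroup, hence open once it is a neighbourhood of `1`. -/
lemma isSmoothRep_of_eventually {G : Type*} [Group G] [TopologicalSpace G]
    [IsTopologicalGroup G] {W : Type*} [AddCommGroup W] [Module ℂ W] {π : Representation ℂ G W}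
    (h : ∀ v, ∀ᶠ g in 𝓝 (1 : G), π g v = v) : IsSmoothRep π := by
  intro v
  let S : Subgroup G :=
    { carrier := {g | π g v = v}
      one_mem' := by simp
      mul_mem' := by
        intro a b ha hb
        change π (a * b) v = v
        rw [map_mul, Module.End.mul_apply, show π b v = v from hb, show π a v = v from ha]
      inv_mem' := by
        intro a ha
        change π a⁻¹ v = v
        nth_rw 1 [← show π a v = v from ha]
        rw [← Module.End.mul_apply, ← map_mul, inv_mul_cancel, map_one, Module.End.one_apply] }
  exact S.isOpen_of_mem_nhds (g := 1) (h v)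

section

variable {F : Type*} [Field F] [TopologicalSpace F] [IsFiniteOrLocalField F]

/-- The general linear group over a finite or local field has a compact open subgroup. -/
lemma exists_isCompact_isOpen_subgroup_GL (ι : Type*) [Fintype ι] [DecidableEq ι] :
    ∃ H : Subgroup (GL ι F), IsCompact (H : Set (GL ι F)) ∧ IsOpen (H : Set (GL ι F)) := by
  obtain ⟨O, hOc, hOo⟩ := IsFiniteOrLocalField.exists_isCompact_isOpen_subring F
  let M : Subring (Matrix ι ι F) := O.matrix
  have hM : (M : Set (Matrix ι ι F)) = Set.univ.pi fun _ => Set.univ.pi fun _ => (O : Set F) := by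
    ext x
    exact ⟨fun h i _ j _ => h i j, fun h i j => h i trivial j trivial⟩
  have hMc : IsCompact (M : Set (Matrix ι ι F)) := by
    rw [hM]
    exact isCompact_univ_pi fun _ => isCompact_univ_pi fun _ => hOc
  have hMo : IsOpen (M : Set (Matrix ι ι F)) := by
    rw [hM]
    exact isOpen_set_pi Set.finite_univ fun _ _ => isOpen_set_pi Set.finite_univ fun _ _ => hOo
  let H : Subgroup (GL ι F) :=
    { carrier := {g | g.val ∈ M ∧ (g⁻¹).val ∈ M}
      one_mem' := by simp [M.one_mem]
      mul_mem' := by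
        rintro a b ⟨ha, ha'⟩ ⟨hb, hb'⟩
        refine ⟨M.mul_mem ha hb, ?_⟩
        rw [mul_inv_rev]
        exact M.mul_mem hb' ha'
      inv_mem' := by
        rintro a ⟨ha, ha'⟩
        exact ⟨ha', by rwa [inv_inv]⟩ }
  refine ⟨H, ?_, (hMo.preimage Units.continuous_val).inter
    (hMo.preimage (Units.continuous_val.comp continuous_inv))⟩
  -- The topology of the unit group comes from the closed embedding `g ↦ (g, g⁻¹)`, so a bound on
  -- both `g` and `g⁻¹` gives compactness.
  have hH : (H : Set (GL ι F)) = Units.embedProduct (Matrix ι ι F) ⁻¹'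
      ((M : Set (Matrix ι ι F)) ×ˢ (MulOpposite.unop ⁻¹' (M : Set (Matrix ι ι F)))) := rfl
  rw [hH]
  refine Topology.IsClosedEmbedding.isCompact_preimage ?_ (hMc.prod ?_)
  · exact Units.isClosedEmbedding_embedProduct
  · exact MulOpposite.opHomeomorph.symm.isCompact_preimage.mpr hMc

variable {m n : ℕ} {V₁ V₂ : Type*} [AddCommGroup V₁] [Module ℂ V₁] [AddCommGroup V₂] [Module ℂ V₂]

lemma isClosed_stdParabolic :
    IsClosed (stdParabolic F m n : Set (GL (Fin m ⊕ Fin n) F)) := by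
  change IsClosed {g : GL (Fin m ⊕ Fin n) F | g.val.toBlocks₂₁ = 0}
  refine isClosed_eq (continuous_matrix fun i j => ?_) continuous_const
  exact Units.continuous_val.matrix_elem (Sum.inr i) (Sum.inl j)

lemma eventually_modularCharacter_stdParabolic :
    ∀ᶠ p in 𝓝 (1 : stdParabolic F m n), modularCharacter p = 1 := by
  obtain ⟨H, hc, ho⟩ := exists_isCompact_isOpen_subgroup_GL (F := F) (Fin m ⊕ Fin n)
  have hc' : IsCompact (H.subgroupOf (stdParabolic F m n) : Set (stdParabolic F m n)) :=
    isClosed_stdParabolic.isClosedEmbedding_subtypeVal.isCompact_preimage hc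
  have ho' : IsOpen (H.subgroupOf (stdParabolic F m n) : Set (stdParabolic F m n)) :=
    ho.preimage continuous_subtype_val
  filter_upwards [ho'.mem_nhds (Subgroup.one_mem _)] with p hp
  exact modularCharacter_eq_one_of_mem_isCompact_isOpen hc' ho' hp

lemma continuous_leviFst : Continuous (leviFst (F := F) m n) := by
  have h : Continuous fun p : stdParabolic F m n => p.val.val.toBlocks₁₁ :=
    continuous_matrix fun i j =>
      (Units.continuous_val.comp continuous_subtype_val).matrix_elem (Sum.inl i) (Sum.inl j)
  exact Units.continuous_iff.mpr ⟨h, h.comp continuous_inv⟩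

lemma continuous_leviSnd : Continuous (leviSnd (F := F) m n) := by
  have h : Continuous fun p : stdParabolic F m n => p.val.val.toBlocks₂₂ :=
    continuous_matrix fun i j =>
      (Units.continuous_val.comp continuous_subtype_val).matrix_elem (Sum.inr i) (Sum.inr j)
  exact Units.continuous_iff.mpr ⟨h, h.comp continuous_inv⟩

lemma isSmoothRep_normalizedInflation {ρ₁ : Representation ℂ (GL (Fin m) F) V₁}
    {ρ₂ : Representation ℂ (GL (Fin n) F) V₂} (hρ₁ : IsSmoothRep ρ₁) (hρ₂ : IsSmoothRep ρ₂) :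
    IsSmoothRep (normalizedInflation ρ₁ ρ₂) := by
  refine isSmoothRep_of_eventually fun v => ?_
  have h₁ (v₁ : V₁) : ∀ᶠ p in 𝓝 (1 : stdParabolic F m n), ρ₁ (leviFst m n p) v₁ = v₁ :=
    (continuous_leviFst.tendsto' 1 1 (map_one _)).eventually (hρ₁.eventually v₁)
  have h₂ (v₂ : V₂) : ∀ᶠ p in 𝓝 (1 : stdParabolic F m n), ρ₂ (leviSnd m n p) v₂ = v₂ :=
    (continuous_leviSnd.tendsto' 1 1 (map_one _)).eventually (hρ₂.eventually v₂)
  have h : ∀ᶠ p in 𝓝 (1 : stdParabolic F m n),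
      TensorProduct.map (ρ₁ (leviFst m n p)) (ρ₂ (leviSnd m n p)) v = v := by
    induction v using TensorProduct.induction_on with
    | zero => simp
    | tmul v₁ v₂ =>
      filter_upwards [h₁ v₁, h₂ v₂] with p hp₁ hp₂
      rw [TensorProduct.map_tmul, hp₁, hp₂]
    | add x y hx hy =>
      filter_upwards [hx, hy] with p hpx hpy
      rw [map_add, hpx, hpy]
  filter_upwards [h, eventually_modularCharacter_stdParabolic] with p hp hδ
  simp [normalizedInflation, hδ, hp]

end

/-! ### The open cell `P w N` and functions supported in it -/

section OpenCell

variable {F : Type*} [Field F] {n : ℕ}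

/-- The block matrix `(1 x; 0 1)`. -/
def unip (x : Matrix (Fin n) (Fin n) F) : GL (Fin n ⊕ Fin n) F where
  val := Matrix.fromBlocks 1 x 0 1
  inv := Matrix.fromBlocks 1 (-x) 0 1
  val_inv := by simp [Matrix.fromBlocks_multiply]
  inv_val := by simp [Matrix.fromBlocks_multiply]

/-- The block matrix `(0 1; 1 0)`. -/
def blockSwap (n : ℕ) (F : Type*) [Field F] : GL (Fin n ⊕ Fin n) F where
  val := Matrix.fromBlocks 0 1 1 0
  inv := Matrix.fromBlocks 0 1 1 0
  val_inv := by simp [Matrix.fromBlocks_multiply]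
  inv_val := by simp [Matrix.fromBlocks_multiply]

lemma unip_add (x y : Matrix (Fin n) (Fin n) F) : unip (x + y) = unip x * unip y := by
  ext1
  simp [unip, Matrix.fromBlocks_multiply, add_comm]

lemma unip_zero : unip (0 : Matrix (Fin n) (Fin n) F) = 1 := by
  ext1
  simp [unip]

lemma unip_mem (x : Matrix (Fin n) (Fin n) F) : unip x ∈ unipRadical F n := ⟨x, rfl⟩

lemma exists_eq_unip (u : unipRadical F n) : ∃ x, u = ⟨unip x, unip_mem x⟩ := by
  obtain ⟨x, hx⟩ := u.2
  exact ⟨x, Subtype.ext (Units.ext hx)⟩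

lemma unipChar_unip (ψ₀ : AddChar F ℂ) (x : Matrix (Fin n) (Fin n) F) :
    unipChar n ψ₀ ⟨unip x, unip_mem x⟩ = ψ₀ x.trace := by
  change ψ₀ (Matrix.fromBlocks 1 x 0 1).toBlocks₁₂.trace = _
  rw [Matrix.toBlocks_fromBlocks₁₂]

lemma unip_mul_diagEmb (x : Matrix (Fin n) (Fin n) F) (g : GL (Fin n) F) :
    unip x * diagEmb F n g = diagEmb F n g * unip ((g⁻¹).val * x * g.val) := by
  ext1
  simp [unip, diagEmb, Matrix.fromBlocks_multiply, ← mul_assoc]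

lemma blockSwap_mul_diagEmb (g : GL (Fin n) F) :
    blockSwap n F * diagEmb F n g = diagEmb F n g * blockSwap n F := by
  ext1
  simp [blockSwap, diagEmb, Matrix.fromBlocks_multiply]

lemma blockSwap_mul_unip_val (x : Matrix (Fin n) (Fin n) F) :
    (blockSwap n F * unip x).val = Matrix.fromBlocks 0 1 1 x := by
  simp [blockSwap, unip, Matrix.fromBlocks_multiply]

lemma blockSwap_mul_unip_inv_val (x : Matrix (Fin n) (Fin n) F) :
    (blockSwap n F * unip x)⁻¹.val = Matrix.fromBlocks (-x) 1 1 0 := by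
  change (Matrix.fromBlocks 1 (-x) 0 1 * Matrix.fromBlocks 0 1 1 0) = _
  simp [Matrix.fromBlocks_multiply]

/-- The lower block row of `p w u(x)` is `(g₂, g₂ x)`, where `g₂` is the second Levi component of
`p`. It determines `x`, and then `p`. -/
lemma toBlocks₂₁_mul_blockSwap_mul_unip (p : stdParabolic F n n)
    (x : Matrix (Fin n) (Fin n) F) :
    (p.val * (blockSwap n F * unip x)).val.toBlocks₂₁ = (leviSnd n n p).val := by
  rw [val_mul_eq_fromBlocks, blockSwap_mul_unip_val]
  simp [leviSnd]

lemma toBlocks₂₂_mul_blockSwap_mul_unip (p : stdParabolic F n n)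
    (x : Matrix (Fin n) (Fin n) F) :
    (p.val * (blockSwap n F * unip x)).val.toBlocks₂₂ = (leviSnd n n p).val * x := by
  have hp : p.val.val.toBlocks₂₁ = 0 := p.2
  rw [val_mul_eq_fromBlocks, blockSwap_mul_unip_val]
  simp [leviSnd, hp]

/-- Uniqueness of the factorization of an element of the open cell `P w N`. -/
lemma openCell_unique {p p' : stdParabolic F n n} {x x' : Matrix (Fin n) (Fin n) F}
    (h : p.val * (blockSwap n F * unip x) = p'.val * (blockSwap n F * unip x')) :
    p = p' ∧ x = x' := by
  have h₁ := congrArg (fun g : GL (Fin n ⊕ Fin n) F => g.val.toBlocks₂₁) h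
  have h₂ := congrArg (fun g : GL (Fin n ⊕ Fin n) F => g.val.toBlocks₂₂) h
  simp only [toBlocks₂₁_mul_blockSwap_mul_unip, toBlocks₂₂_mul_blockSwap_mul_unip] at h₁ h₂
  rw [← h₁] at h₂
  have hx : x = x' := (leviSnd n n p).isUnit.mul_left_cancel h₂
  subst hx
  exact ⟨Subtype.ext (mul_right_cancel h), rfl⟩

/-- The coordinate `c⁻¹ d` of a block matrix `(a b; c d)` of the open cell. -/
noncomputable def cellCoord (g : GL (Fin n ⊕ Fin n) F) : Matrix (Fin n) (Fin n) F :=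
  (g.val.toBlocks₂₁)⁻¹ * g.val.toBlocks₂₂

lemma cellCoord_blockSwap_mul_unip (x : Matrix (Fin n) (Fin n) F) :
    cellCoord (blockSwap n F * unip x) = x := by
  rw [cellCoord, blockSwap_mul_unip_val]
  simp

/-- With lower block row `(c, d)`, the lower left block of the product is `d - c (c⁻¹ d) = 0`. So
invertibility of `c` puts `g` in the cell. -/
lemma mul_inv_cellCoord_mem {g : GL (Fin n ⊕ Fin n) F} (hg : g.val.toBlocks₂₁.det ≠ 0) :
    g * (blockSwap n F * unip (cellCoord g))⁻¹ ∈ stdParabolic F n n := by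
  change (g * (blockSwap n F * unip (cellCoord g))⁻¹).val.toBlocks₂₁ = 0
  rw [val_mul_eq_fromBlocks, blockSwap_mul_unip_inv_val]
  simp [cellCoord, ← mul_assoc, Matrix.mul_nonsing_inv _ (isUnit_iff_ne_zero.mpr hg)]

variable {W : Type*} [AddCommGroup W] [Module ℂ W]

open Classical in
/-- The function supported on `P w K` with values `f (p w u) = σ(p) v` for `u ∈ K`, where `K` is a
subgroup of the unipotent radical `N ≅ M_n(F)`. -/
noncomputable def cellFun (σ : Representation ℂ (stdParabolic F n n) W)
    (K : AddSubgroup (Matrix (Fin n) (Fin n) F)) (v : W) (g : GL (Fin n ⊕ Fin n) F) : W :=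
  if h : ∃ q : stdParabolic F n n × Matrix (Fin n) (Fin n) F,
    q.2 ∈ K ∧ g = q.1.val * (blockSwap n F * unip q.2) then σ h.choose.1 v else 0

variable (σ : Representation ℂ (stdParabolic F n n) W)
  (K : AddSubgroup (Matrix (Fin n) (Fin n) F))

open Classical in
lemma cellFun_apply (v : W) (p : stdParabolic F n n) (x : Matrix (Fin n) (Fin n) F) :
    cellFun σ K v (p.val * (blockSwap n F * unip x)) = if x ∈ K then σ p v else 0 := by
  by_cases hx : x ∈ K
  · have h : ∃ q : stdParabolic F n n × Matrix (Fin n) (Fin n) F, q.2 ∈ K ∧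
        p.val * (blockSwap n F * unip x) = q.1.val * (blockSwap n F * unip q.2) :=
      ⟨(p, x), hx, rfl⟩
    rw [cellFun, dif_pos h, if_pos hx, ← (openCell_unique h.choose_spec.2).1]
  · rw [cellFun, dif_neg, if_neg hx]
    rintro ⟨q, hq, h⟩
    exact hx ((openCell_unique h).2 ▸ hq)

lemma cellFun_of_forall_ne (v : W) {g : GL (Fin n ⊕ Fin n) F}
    (hg : ∀ (p : stdParabolic F n n) (x : Matrix (Fin n) (Fin n) F),
      g ≠ p.val * (blockSwap n F * unip x)) : cellFun σ K v g = 0 := by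
  rw [cellFun, dif_neg]
  rintro ⟨q, -, h⟩
  exact hg _ _ h

/-- Induction principle: an element of `G` is in the open cell or outside it. -/
lemma openCell_cases {C : GL (Fin n ⊕ Fin n) F → Prop}
    (h₁ : ∀ (p : stdParabolic F n n) (x : Matrix (Fin n) (Fin n) F),
      C (p.val * (blockSwap n F * unip x)))
    (h₂ : ∀ g, (∀ (p : stdParabolic F n n) (x : Matrix (Fin n) (Fin n) F),
      g ≠ p.val * (blockSwap n F * unip x)) → C g) (g) : C g := by
  by_cases hg : ∃ (p : stdParabolic F n n) (x : Matrix (Fin n) (Fin n) F),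
      g = p.val * (blockSwap n F * unip x)
  · obtain ⟨p, x, rfl⟩ := hg
    exact h₁ p x
  · push Not at hg
    exact h₂ g hg

lemma cellFun_add (v w : W) : cellFun σ K (v + w) = cellFun σ K v + cellFun σ K w := by
  classical
  funext g
  induction g using openCell_cases with
  | h₁ p x =>
    simp only [Pi.add_apply, cellFun_apply]
    split_ifs <;> simp
  | h₂ g hg => simp [cellFun_of_forall_ne σ K _ hg]

lemma cellFun_smul (a : ℂ) (v : W) : cellFun σ K (a • v) = a • cellFun σ K v := by
  classical
  funext g
  induction g using openCell_cases with
  | h₁ p x =>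
    simp only [Pi.smul_apply, cellFun_apply]
    split_ifs <;> simp
  | h₂ g hg => simp [cellFun_of_forall_ne σ K _ hg]

lemma cellFun_mul_left (v : W) (p : stdParabolic F n n) (g : GL (Fin n ⊕ Fin n) F) :
    cellFun σ K v (p.val * g) = σ p (cellFun σ K v g) := by
  classical
  induction g using openCell_cases with
  | h₁ q x =>
    rw [← mul_assoc, ← Subgroup.coe_mul, cellFun_apply, cellFun_apply]
    split_ifs <;> simp
  | h₂ g hg =>
    rw [cellFun_of_forall_ne σ K _ hg, cellFun_of_forall_ne, map_zero]
    intro q x h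
    refine hg (p⁻¹ * q) x ?_
    rw [Subgroup.coe_mul, mul_assoc, ← h]
    simp

variable [TopologicalSpace F] [IsFiniteOrLocalField F]

lemma continuous_unip : Continuous (unip : Matrix (Fin n) (Fin n) F → _) := by
  refine Units.continuous_iff.mpr ⟨?_, ?_⟩
  · exact Continuous.matrix_fromBlocks continuous_const continuous_id continuous_const
      continuous_const
  · exact Continuous.matrix_fromBlocks continuous_const continuous_neg continuous_const
      continuous_const

lemma continuousAt_cellCoord {g : GL (Fin n ⊕ Fin n) F} (hg : g.val.toBlocks₂₁.det ≠ 0) :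
    ContinuousAt cellCoord g := by
  have h₁ : Continuous fun g : GL (Fin n ⊕ Fin n) F => g.val.toBlocks₂₁ :=
    continuous_matrix fun i j => Units.continuous_val.matrix_elem (Sum.inr i) (Sum.inl j)
  have h₂ : Continuous fun g : GL (Fin n ⊕ Fin n) F => g.val.toBlocks₂₂ :=
    continuous_matrix fun i j => Units.continuous_val.matrix_elem (Sum.inr i) (Sum.inr j)
  have h₃ : ContinuousAt (fun g : GL (Fin n ⊕ Fin n) F => (g.val.toBlocks₂₁)⁻¹) g := by
    simp only [Matrix.inv_def, Ring.inverse_eq_inv']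
    exact (h₁.matrix_det.continuousAt.inv₀ hg).smul h₁.matrix_adjugate.continuousAt
  exact (continuous_fst.mul continuous_snd).continuousAt.comp (h₃.prodMk h₂.continuousAt)

variable {σ K}

/-- For `g` near `w u`, both factors of `g = p w x` depend continuously on `g`: `x` stays in the
open set `K`, and `p` stays near `1`, where it fixes `v`. -/
lemma eventually_cellFun_eq (hσ : IsSmoothRep σ) (hK : IsOpen (K : Set (Matrix (Fin n) (Fin n) F)))
    (v : W) {u : Matrix (Fin n) (Fin n) F} (hu : u ∈ K) :
    ∀ᶠ g in 𝓝 (blockSwap n F * unip u), cellFun σ K v g = v := by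
  classical
  obtain ⟨O, hO, hOσ⟩ := isOpen_induced_iff.mp (hσ v)
  have hdet : (blockSwap n F * unip u).val.toBlocks₂₁.det ≠ 0 := by
    rw [blockSwap_mul_unip_val]
    simp
  have hc := continuousAt_cellCoord hdet
  have hcu : cellCoord (blockSwap n F * unip u) = u := cellCoord_blockSwap_mul_unip u
  have hd : ∀ᶠ g in 𝓝 (blockSwap n F * unip u), g.val.toBlocks₂₁.det ≠ 0 := by
    have h₁ : Continuous fun g : GL (Fin n ⊕ Fin n) F => g.val.toBlocks₂₁ :=
      continuous_matrix fun i j => Units.continuous_val.matrix_elem (Sum.inr i) (Sum.inl j)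
    exact h₁.matrix_det.continuousAt.eventually_ne hdet
  have hp : ContinuousAt (fun g => g * (blockSwap n F * unip (cellCoord g))⁻¹)
      (blockSwap n F * unip u) :=
    continuousAt_id.mul (continuousAt_const.mul (continuous_unip.continuousAt.comp hc)).inv
  have hpO : ∀ᶠ g in 𝓝 (blockSwap n F * unip u),
      g * (blockSwap n F * unip (cellCoord g))⁻¹ ∈ O := by
    refine hp.eventually_mem (hO.mem_nhds ?_)
    rw [hcu, mul_inv_cancel]
    have : (1 : stdParabolic F n n) ∈ Subtype.val ⁻¹' O := by
      rw [hOσ]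
      simp
    exact this
  have hcK : ∀ᶠ g in 𝓝 (blockSwap n F * unip u), cellCoord g ∈ K :=
    hc.eventually_mem (hK.mem_nhds (by rwa [hcu]))
  filter_upwards [hd, hpO, hcK] with g hgd hgO hgK
  have hgp : (⟨_, mul_inv_cellCoord_mem hgd⟩ : stdParabolic F n n) ∈ {p | σ p v = v} := by
    rw [← hOσ]
    exact hgO
  have hg : g = (⟨_, mul_inv_cellCoord_mem hgd⟩ : stdParabolic F n n).val *
      (blockSwap n F * unip (cellCoord g)) :=
    (inv_mul_cancel_right _ _).symm
  rw [hg, cellFun_apply, if_pos hgK]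
  exact hgp

lemma cellFun_mem (hσ : IsSmoothRep σ) (hKo : IsOpen (K : Set (Matrix (Fin n) (Fin n) F)))
    (hKc : IsCompact (K : Set (Matrix (Fin n) (Fin n) F))) (v : W) :
    cellFun σ K v ∈ compactIndSpace (stdParabolic F n n) σ := by
  classical
  let C : Set (GL (Fin n ⊕ Fin n) F) := (fun x => blockSwap n F * unip x) '' K
  have hC : IsCompact C := hKc.image (continuous_const.mul continuous_unip)
  have hsupp (g : GL (Fin n ⊕ Fin n) F) (hg : cellFun σ K v g ≠ 0) :
      ∃ (p : stdParabolic F n n) (x : Matrix (Fin n) (Fin n) F), x ∈ K ∧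
        g = p.val * (blockSwap n F * unip x) := by
    induction g using openCell_cases with
    | h₁ p x =>
      rw [cellFun_apply] at hg
      exact ⟨p, x, by_contra fun h => hg (if_neg h), rfl⟩
    | h₂ g hg' => exact absurd (cellFun_of_forall_ne σ K v hg') hg
  refine ⟨cellFun_mul_left σ K v, ?_, C, hC, fun g hg => ?_⟩
  · let J : Subgroup (GL (Fin n ⊕ Fin n) F) :=
      { carrier := {k | ∀ g, cellFun σ K v (g * k) = cellFun σ K v g}
        one_mem' := by simp
        mul_mem' := by
          intro a b ha hb g
          rw [← mul_assoc, hb, ha]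
        inv_mem' := by
          intro a ha g
          rw [← ha (g * a⁻¹), inv_mul_cancel_right] }
    have hCU : C ⊆ interior {g | cellFun σ K v g = v} := by
      rintro _ ⟨u, hu, rfl⟩
      exact mem_interior_iff_mem_nhds.mpr (eventually_cellFun_eq hσ hKo v hu)
    -- Compactness of `w K` makes the local constancy uniform: one neighbourhood `S` of `1` works at
    -- all its points, and equivariance under `P` extends this to the whole support.
    obtain ⟨S, hS, hCS⟩ := compact_open_separated_mul_right hC isOpen_interior hCU
    have hS' (k : GL (Fin n ⊕ Fin n) F) (hk : k ∈ S) (g : GL (Fin n ⊕ Fin n) F)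
        (hg : cellFun σ K v g ≠ 0) : cellFun σ K v (g * k) = cellFun σ K v g := by
      obtain ⟨p, x, hx, rfl⟩ := hsupp g hg
      have h := interior_subset (hCS (Set.mul_mem_mul ⟨x, hx, rfl⟩ hk))
      rw [mul_assoc, cellFun_mul_left, show cellFun σ K v _ = v from h, cellFun_apply, if_pos hx]
    have hJ : IsOpen (J : Set (GL (Fin n ⊕ Fin n) F)) := by
      refine J.isOpen_of_mem_nhds (g := 1) ?_
      -- Where the function vanishes at `g` but not at `g k`, the support statement is applied at `g
      -- k` with `k⁻¹`. Hence both `k` and `k⁻¹` must lie in `S`.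
      filter_upwards [hS, inv_mem_nhds_one _ hS] with k hk hk' g
      by_cases hg : cellFun σ K v g = 0
      · by_contra hne
        rw [hg] at hne
        have := hS' k⁻¹ hk' (g * k) hne
        rw [mul_inv_cancel_right, hg] at this
        exact hne this.symm
      · exact hS' k hk g hg
    exact ⟨⟨J, hJ⟩, fun g k hk => hk g⟩
  · obtain ⟨p, x, hx, rfl⟩ := hsupp g hg
    exact ⟨p, _, ⟨x, hx, rfl⟩, rfl⟩

/-- The functions `cellFun σ K v` as elements of the compactly induced representation. -/
noncomputable def cellMap (hσ : IsSmoothRep σ)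
    (hKo : IsOpen (K : Set (Matrix (Fin n) (Fin n) F)))
    (hKc : IsCompact (K : Set (Matrix (Fin n) (Fin n) F))) :
    W →ₗ[ℂ] compactIndSpace (stdParabolic F n n) σ where
  toFun v := ⟨cellFun σ K v, cellFun_mem hσ hKo hKc v⟩
  map_add' v w := Subtype.ext (cellFun_add σ K v w)
  map_smul' a v := Subtype.ext (cellFun_smul σ K a v)

end OpenCell

/-! ### Compact open subgroups of `M_n(F)` and their conjugates -/

section ConjLattice

variable {F : Type*} [Field F] {n : ℕ}

/-- The subgroup `g K g⁻¹` of `M_n(F)`. -/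
def conjLattice (g : GL (Fin n) F) (K : AddSubgroup (Matrix (Fin n) (Fin n) F)) :
    AddSubgroup (Matrix (Fin n) (Fin n) F) :=
  K.comap ((AddMonoidHom.mulRight g.val).comp (AddMonoidHom.mulLeft (g⁻¹).val))

lemma addChar_trace_conjLattice {ψ₀ : AddChar F ℂ} {K : AddSubgroup (Matrix (Fin n) (Fin n) F)}
    (hK : ∀ x ∈ K, ψ₀ x.trace = 1) (g : GL (Fin n) F) :
    ∀ x ∈ conjLattice g K, ψ₀ x.trace = 1 := by
  intro x hx
  rw [← hK _ hx]
  change _ = ψ₀ ((g⁻¹).val * x * g.val).trace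
  rw [Matrix.trace_mul_comm, ← mul_assoc, ← Units.val_mul, mul_inv_cancel, Units.val_one, one_mul]

end ConjLattice

section Lattices

variable {F : Type*} [Field F] [TopologicalSpace F] [IsFiniteOrLocalField F] {n : ℕ}

instance : LocallyCompactSpace (Matrix (Fin n) (Fin n) F) :=
  inferInstanceAs (LocallyCompactSpace (Fin n → Fin n → F))

variable (F n) in
lemma exists_isCompact_isOpen_addSubgroup_matrix :
    ∃ K : AddSubgroup (Matrix (Fin n) (Fin n) F), IsCompact (K : Set (Matrix (Fin n) (Fin n) F)) ∧
      IsOpen (K : Set (Matrix (Fin n) (Fin n) F)) := by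
  obtain ⟨O, hOc, hOo⟩ := IsFiniteOrLocalField.exists_isCompact_isOpen_subring F
  have hM : ((O.matrix (n := Fin n)).toAddSubgroup : Set (Matrix (Fin n) (Fin n) F)) =
      Set.univ.pi fun _ => Set.univ.pi fun _ => (O : Set F) := by
    ext x
    exact ⟨fun h i _ j _ => h i j, fun h i j => h i trivial j trivial⟩
  refine ⟨(O.matrix (n := Fin n)).toAddSubgroup, ?_, ?_⟩
  · rw [hM]
    exact isCompact_univ_pi fun _ => isCompact_univ_pi fun _ => hOc
  · rw [hM]
    exact isOpen_set_pi Set.finite_univ fun _ _ => isOpen_set_pi Set.finite_univ fun _ _ => hOo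

lemma isCompact_sup_addSubgroup {A : Type*} [AddCommGroup A] [TopologicalSpace A]
    [IsTopologicalAddGroup A] {B C : AddSubgroup A} (hB : IsCompact (B : Set A))
    (hC : IsCompact (C : Set A)) : IsCompact ((B ⊔ C : AddSubgroup A) : Set A) := by
  rw [AddSubgroup.add_normal]
  exact hB.add hC

/-- Every matrix lies in a compact open subgroup of `M_n(F)`. -/
lemma exists_isCompact_isOpen_addSubgroup_mem (t : Matrix (Fin n) (Fin n) F) :
    ∃ K : AddSubgroup (Matrix (Fin n) (Fin n) F), IsCompact (K : Set (Matrix (Fin n) (Fin n) F)) ∧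
      IsOpen (K : Set (Matrix (Fin n) (Fin n) F)) ∧ t ∈ K := by
  obtain ⟨O, hOc, -⟩ := IsFiniteOrLocalField.exists_isCompact_isOpen_subring F
  obtain ⟨K, hKc, hKo⟩ := exists_isCompact_isOpen_addSubgroup_matrix F n
  let C : AddSubgroup (Matrix (Fin n) (Fin n) F) :=
    O.toAddSubgroup.map ((LinearMap.toSpanSingleton F _ t).toAddMonoidHom)
  have hC : IsCompact (C : Set (Matrix (Fin n) (Fin n) F)) :=
    hOc.image (continuous_id.smul continuous_const)
  refine ⟨K ⊔ C, isCompact_sup_addSubgroup hKc hC, AddSubgroup.isOpen_mono le_sup_left hKo, ?_⟩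
  exact AddSubgroup.mem_sup_right ⟨1, O.one_mem, one_smul F t⟩

/-- There is a compact open subgroup of `M_n(F)` on which `ψ₀ ∘ tr` is trivial. -/
lemma exists_isCompact_isOpen_addSubgroup_addChar {ψ₀ : AddChar F ℂ}
    (hψ₀ : IsLocallyConstant ψ₀) (n : ℕ) :
    ∃ K : AddSubgroup (Matrix (Fin n) (Fin n) F), IsCompact (K : Set (Matrix (Fin n) (Fin n) F)) ∧
      IsOpen (K : Set (Matrix (Fin n) (Fin n) F)) ∧ ∀ x ∈ K, ψ₀ x.trace = 1 := by
  obtain ⟨K, hKc, hKo⟩ := exists_isCompact_isOpen_addSubgroup_matrix F n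
  let H : AddSubgroup (Matrix (Fin n) (Fin n) F) :=
    { carrier := {x | ψ₀ x.trace = 1}
      zero_mem' := by simp
      add_mem' := by
        intro a b ha hb
        change ψ₀ (a + b).trace = 1
        rw [Matrix.trace_add, AddChar.map_add_eq_mul, show ψ₀ a.trace = 1 from ha,
          show ψ₀ b.trace = 1 from hb, one_mul]
      neg_mem' := by
        intro a ha
        change ψ₀ (-a).trace = 1
        rw [Matrix.trace_neg, AddChar.map_neg_eq_inv, show ψ₀ a.trace = 1 from ha, inv_one] }
  have hH : IsOpen (H : Set (Matrix (Fin n) (Fin n) F)) :=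
    (hψ₀ {1}).preimage (continuous_id.matrix_trace)
  exact ⟨K ⊓ H, hKc.inter_right (H.isClosed_of_isOpen hH), hKo.inter hH, fun x hx => hx.2⟩

lemma isOpen_conjLattice (g : GL (Fin n) F) {K : AddSubgroup (Matrix (Fin n) (Fin n) F)}
    (hK : IsOpen (K : Set (Matrix (Fin n) (Fin n) F))) :
    IsOpen (conjLattice g K : Set (Matrix (Fin n) (Fin n) F)) :=
  hK.preimage ((continuous_const.mul continuous_id).mul continuous_const)

lemma isCompact_conjLattice (g : GL (Fin n) F) {K : AddSubgroup (Matrix (Fin n) (Fin n) F)}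
    (hK : IsCompact (K : Set (Matrix (Fin n) (Fin n) F))) :
    IsCompact (conjLattice g K : Set (Matrix (Fin n) (Fin n) F)) := by
  have : (conjLattice g K : Set (Matrix (Fin n) (Fin n) F)) =
      (fun x => g.val * x * (g⁻¹).val) '' K := by
    ext x
    constructor
    · intro hx
      refine ⟨_, hx, ?_⟩
      simp [mul_assoc]
    · rintro ⟨y, hy, rfl⟩
      change (g⁻¹).val * (g.val * y * (g⁻¹).val) * g.val ∈ K
      simpa [← mul_assoc, mul_assoc] using hy
  rw [this]
  exact hK.image ((continuous_const.mul continuous_id).mul continuous_const)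

end Lattices

/-! ### Classes of cell functions in the twisted Jacquet module -/

section Jacquet

variable {F : Type*} [Field F] [TopologicalSpace F] [IsFiniteOrLocalField F] {n : ℕ}
  {W : Type*} [AddCommGroup W] [Module ℂ W] {σ : Representation ℂ (stdParabolic F n n) W}

lemma compactInd_apply {G : Type*} [Group G] [TopologicalSpace G] [IsTopologicalGroup G]
    {H : Subgroup G} {τ : Representation ℂ H W} (x : G) (f : compactIndSpace H τ) (g : G) :
    (compactInd H τ x f).val g = f.val (g * x) := rfl

lemma mkQ_twistedKernel {G : Type*} [Group G] {V : Type*} [AddCommGroup V] [Module ℂ V]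
    (π : Representation ℂ G V) (U : Subgroup G) (θ : U →* ℂ) (u : U) (v : V) :
    (twistedKernel π U θ).mkQ (π u v) = θ u • (twistedKernel π U θ).mkQ v := by
  rw [← map_smul, ← sub_eq_zero, ← map_sub, Submodule.mkQ_apply, Submodule.Quotient.mk_eq_zero]
  exact Submodule.subset_span ⟨u, v, rfl⟩

variable {K L : AddSubgroup (Matrix (Fin n) (Fin n) F)}

lemma finite_quotient_addSubgroupOf (hKc : IsCompact (K : Set (Matrix (Fin n) (Fin n) F)))
    (hLo : IsOpen (L : Set (Matrix (Fin n) (Fin n) F))) : Finite (K ⧸ L.addSubgroupOf K) := by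
  have : CompactSpace K := isCompact_iff_compactSpace.mp hKc
  exact AddSubgroup.quotient_finite_of_isOpen _ (hLo.preimage continuous_subtype_val)

lemma relIndex_pos (hKc : IsCompact (K : Set (Matrix (Fin n) (Fin n) F)))
    (hLo : IsOpen (L : Set (Matrix (Fin n) (Fin n) F))) : 0 < L.relIndex K := by
  have := finite_quotient_addSubgroupOf hKc hLo
  exact Nat.card_pos

/-- The cosets `q + L` partition `K`, and right translation by `u(-q)` moves the support from `P w
L` to `P w (q + L)`. -/
lemma cellMap_eq_sum (hσ : IsSmoothRep σ)
    (hKo : IsOpen (K : Set (Matrix (Fin n) (Fin n) F)))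
    (hKc : IsCompact (K : Set (Matrix (Fin n) (Fin n) F)))
    (hLo : IsOpen (L : Set (Matrix (Fin n) (Fin n) F)))
    (hLc : IsCompact (L : Set (Matrix (Fin n) (Fin n) F))) (hLK : L ≤ K)
    [Fintype (K ⧸ L.addSubgroupOf K)] (v : W) :
    cellMap hσ hKo hKc v = ∑ q : K ⧸ L.addSubgroupOf K,
      compactInd (stdParabolic F n n) σ (unip (-(q.out : Matrix (Fin n) (Fin n) F)))
        (cellMap hσ hLo hLc v) := by
  classical
  ext g
  simp only [Submodule.coe_sum, Finset.sum_apply, compactInd_apply]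
  change cellFun σ K v g = ∑ q : K ⧸ L.addSubgroupOf K, cellFun σ L v (g * unip (-_))
  induction g using openCell_cases with
  | h₁ p x =>
    simp only [mul_assoc, ← unip_add, cellFun_apply]
    split_ifs with hx
    · rw [Finset.sum_eq_single (QuotientAddGroup.mk (⟨x, hx⟩ : K)), if_pos]
      · have := QuotientAddGroup.eq.mp (Quotient.out_eq
          (QuotientAddGroup.mk (s := L.addSubgroupOf K) (⟨x, hx⟩ : K)))
        rw [add_comm]
        exact this
      · intro q _ hq
        rw [if_neg]
        intro h
        refine hq ?_
        rw [← Quotient.out_eq q]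
        refine QuotientAddGroup.eq.mpr ?_
        rw [AddSubgroup.mem_addSubgroupOf]
        rwa [add_comm] at h
      · simp
    · refine (Finset.sum_eq_zero fun q _ => if_neg fun h => hx ?_).symm
      have := K.add_mem (hLK h) q.out.2
      rwa [neg_add_cancel_right] at this
  | h₂ g hg =>
    rw [cellFun_of_forall_ne σ K v hg]
    refine (Finset.sum_eq_zero fun q _ => cellFun_of_forall_ne σ L v fun p x h => ?_).symm
    refine hg p (x + q.out) ?_
    rw [unip_add, ← mul_assoc, ← mul_assoc, mul_assoc p.val, ← h, mul_assoc, ← unip_add,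
      neg_add_cancel, unip_zero, mul_one]

/-- Since the character is trivial on `K`, all the translates in `cellMap_eq_sum` have the same
class, and there are `[K : L]` of them. -/
lemma mkQ_cellMap_of_le (ψ₀ : AddChar F ℂ) (hσ : IsSmoothRep σ)
    (hKo : IsOpen (K : Set (Matrix (Fin n) (Fin n) F)))
    (hKc : IsCompact (K : Set (Matrix (Fin n) (Fin n) F)))
    (hLo : IsOpen (L : Set (Matrix (Fin n) (Fin n) F)))
    (hLc : IsCompact (L : Set (Matrix (Fin n) (Fin n) F))) (hLK : L ≤ K)
    (hKψ : ∀ x ∈ K, ψ₀ x.trace = 1) (v : W) :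
    (twistedKernel (compactInd (stdParabolic F n n) σ) (unipRadical F n)
        (unipChar n ψ₀)).mkQ (cellMap hσ hKo hKc v) =
      (L.relIndex K : ℂ) • (twistedKernel (compactInd (stdParabolic F n n) σ) (unipRadical F n)
        (unipChar n ψ₀)).mkQ (cellMap hσ hLo hLc v) := by
  have := finite_quotient_addSubgroupOf hKc hLo
  have := Fintype.ofFinite (K ⧸ L.addSubgroupOf K)
  have key (x : Matrix (Fin n) (Fin n) F) (hx : x ∈ K) :
      (twistedKernel (compactInd (stdParabolic F n n) σ) (unipRadical F n)
        (unipChar n ψ₀)).mkQ (compactInd (stdParabolic F n n) σ (unip x)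
          (cellMap hσ hLo hLc v)) =
      (twistedKernel (compactInd (stdParabolic F n n) σ) (unipRadical F n)
        (unipChar n ψ₀)).mkQ (cellMap hσ hLo hLc v) := by
    have h := mkQ_twistedKernel (compactInd (stdParabolic F n n) σ) (unipRadical F n)
      (unipChar n ψ₀) ⟨unip x, unip_mem x⟩ (cellMap hσ hLo hLc v)
    rwa [unipChar_unip, hKψ x hx, one_smul] at h
  rw [cellMap_eq_sum hσ hKo hKc hLo hLc hLK, _root_.map_sum,
    Finset.sum_congr rfl fun q _ => key _ (K.neg_mem q.out.2), Finset.sum_const,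
    Finset.card_univ, ← Nat.card_eq_fintype_card, ← Nat.cast_smul_eq_nsmul ℂ]
  rfl

lemma isLocallyConstant_of_mem_compactIndSpace {G : Type*} [Group G] [TopologicalSpace G]
    [IsTopologicalGroup G] {H : Subgroup G} {τ : Representation ℂ H W} {f : G → W}
    (hf : f ∈ compactIndSpace H τ) : IsLocallyConstant f := by
  obtain ⟨-, ⟨J, hJ⟩, -⟩ := hf
  rw [IsLocallyConstant.iff_eventually_eq]
  intro g
  have h : ∀ᶠ y in 𝓝 g, g⁻¹ * y ∈ J :=
    (continuous_const_mul g⁻¹).continuousAt.eventually_mem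
      (J.isOpen.mem_nhds (by simp))
  filter_upwards [h] with y hy
  rw [← hJ g _ hy, mul_inv_cancel_left]

/-- The integrand of the Whittaker-type functionals `f ↦ ∫_B ψ(-x) ℓ(f(w x)) dx`. -/
noncomputable def cellIntegrand (ψ₀ : AddChar F ℂ) (l : W →ₗ[ℂ] ℂ)
    (f : compactIndSpace (stdParabolic F n n) σ) (x : Matrix (Fin n) (Fin n) F) : ℂ :=
  ψ₀ (-x.trace) * l (f.val (blockSwap n F * unip x))

lemma continuous_cellIntegrand {ψ₀ : AddChar F ℂ} (hψ₀ : IsLocallyConstant ψ₀) (l : W →ₗ[ℂ] ℂ)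
    (f : compactIndSpace (stdParabolic F n n) σ) : Continuous (cellIntegrand ψ₀ l f) := by
  refine (hψ₀.continuous.comp (continuous_id.matrix_trace.neg)).mul ?_
  exact (((isLocallyConstant_of_mem_compactIndSpace f.2).comp l).comp_continuous
    (continuous_const.mul continuous_unip)).continuous

lemma cellIntegrand_unip (ψ₀ : AddChar F ℂ) (l : W →ₗ[ℂ] ℂ)
    (f : compactIndSpace (stdParabolic F n n) σ) (t x : Matrix (Fin n) (Fin n) F) :
    cellIntegrand ψ₀ l (compactInd (stdParabolic F n n) σ (unip t) f) x =
      ψ₀ t.trace * cellIntegrand ψ₀ l f (x + t) := by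
  simp only [cellIntegrand, compactInd_apply, mul_assoc, unip_add]
  rw [← mul_assoc (ψ₀ t.trace), ← AddChar.map_add_eq_mul, Matrix.trace_add]
  congr 2
  abel

lemma setIntegral_add_right_addSubgroup {A : Type*} [AddGroup A] [MeasurableSpace A]
    [MeasurableAdd A] (μ : Measure A) [μ.IsAddRightInvariant] {B : AddSubgroup A}
    (hB : MeasurableSet (B : Set A)) (f : A → ℂ) {t : A} (ht : t ∈ B) :
    ∫ x in B, f (x + t) ∂μ = ∫ x in B, f x ∂μ := by
  rw [← integral_indicator hB, ← integral_indicator hB,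
    ← integral_add_right_eq_self ((B : Set A).indicator f) t]
  congr 1
  funext x
  have : x ∈ (B : Set A) ↔ x + t ∈ (B : Set A) := (AddSubgroup.add_mem_cancel_right B ht).symm
  by_cases hx : x ∈ (B : Set A)
  · rw [Set.indicator_of_mem hx, Set.indicator_of_mem (this.mp hx)]
  · rw [Set.indicator_of_notMem hx, Set.indicator_of_notMem (this.not.mp hx)]

/-- The elements of `V(N, ψ)` are killed by `f ↦ ∫_B ψ(-x) ℓ(f(w x)) dx` for all sufficiently
large compact subgroups `B`. -/
lemma exists_setIntegral_eq_zero_of_mem_twistedKernel [MeasurableSpace (Matrix (Fin n) (Fin n) F)]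
    [BorelSpace (Matrix (Fin n) (Fin n) F)] (μ : Measure (Matrix (Fin n) (Fin n) F))
    [μ.IsAddHaarMeasure] {ψ₀ : AddChar F ℂ} (hψ₀ : IsLocallyConstant ψ₀) (l : W →ₗ[ℂ] ℂ)
    {f : compactIndSpace (stdParabolic F n n) σ}
    (hf : f ∈ twistedKernel (compactInd (stdParabolic F n n) σ) (unipRadical F n)
      (unipChar n ψ₀)) :
    ∃ B₀ : AddSubgroup (Matrix (Fin n) (Fin n) F),
      IsCompact (B₀ : Set (Matrix (Fin n) (Fin n) F)) ∧
      IsOpen (B₀ : Set (Matrix (Fin n) (Fin n) F)) ∧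
      ∀ B : AddSubgroup (Matrix (Fin n) (Fin n) F),
        IsCompact (B : Set (Matrix (Fin n) (Fin n) F)) → B₀ ≤ B →
        ∫ x in B, cellIntegrand ψ₀ l f x ∂μ = 0 := by
  have hint (f : compactIndSpace (stdParabolic F n n) σ)
      {B : AddSubgroup (Matrix (Fin n) (Fin n) F)}
      (hB : IsCompact (B : Set (Matrix (Fin n) (Fin n) F))) :
      IntegrableOn (cellIntegrand ψ₀ l f) B μ :=
    (continuous_cellIntegrand hψ₀ l f).continuousOn.integrableOn_compact hB
  induction hf using Submodule.span_induction with
  | mem f hf =>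
    obtain ⟨u, f, rfl⟩ := hf
    obtain ⟨t, rfl⟩ := exists_eq_unip u
    -- Any `B` containing `t` is stable under translation by `t`, so the integrals of `x ↦ F(x + t)`
    -- and `F` over `B` cancel.
    obtain ⟨B₀, hc, ho, ht⟩ := exists_isCompact_isOpen_addSubgroup_mem t
    refine ⟨B₀, hc, ho, fun B hB hle => ?_⟩
    have h (x : Matrix (Fin n) (Fin n) F) : cellIntegrand ψ₀ l
        (compactInd (stdParabolic F n n) σ (unip t) f - ψ₀ t.trace • f) x =
        ψ₀ t.trace * (cellIntegrand ψ₀ l f (x + t) - cellIntegrand ψ₀ l f x) := by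
      rw [mul_sub, ← cellIntegrand_unip]
      simp only [cellIntegrand, Submodule.coe_sub, Pi.sub_apply, map_sub, mul_sub,
        Submodule.coe_smul, Pi.smul_apply, map_smul, smul_eq_mul]
      ring
    have hint' : IntegrableOn (fun x => cellIntegrand ψ₀ l f (x + t)) B μ :=
      ((continuous_cellIntegrand hψ₀ l f).comp
        (continuous_add_const t)).continuousOn.integrableOn_compact hB
    simp only [unipChar_unip]
    rw [integral_congr_ae (Eventually.of_forall h), integral_const_mul,
      integral_sub hint' (hint f hB), setIntegral_add_right_addSubgroup μ
        (AddSubgroup.isOpen_mono hle ho).measurableSet _ (hle ht), sub_self, mul_zero]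
  | zero =>
    obtain ⟨B₀, hc, ho⟩ := exists_isCompact_isOpen_addSubgroup_matrix F n
    exact ⟨B₀, hc, ho, fun B hB _ => by simp [cellIntegrand]⟩
  | add f₁ f₂ _ _ h₁ h₂ =>
    obtain ⟨B₁, hc₁, ho₁, h₁⟩ := h₁
    obtain ⟨B₂, hc₂, ho₂, h₂⟩ := h₂
    refine ⟨B₁ ⊔ B₂, isCompact_sup_addSubgroup hc₁ hc₂,
      AddSubgroup.isOpen_mono le_sup_left ho₁, fun B hB hle => ?_⟩
    have h (x : Matrix (Fin n) (Fin n) F) : cellIntegrand ψ₀ l (f₁ + f₂) x =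
        cellIntegrand ψ₀ l f₁ x + cellIntegrand ψ₀ l f₂ x := by
      simp [cellIntegrand, mul_add]
    rw [integral_congr_ae (Eventually.of_forall h), integral_add (hint f₁ hB) (hint f₂ hB),
      h₁ B hB (le_sup_left.trans hle), h₂ B hB (le_sup_right.trans hle), add_zero]
  | smul a f _ h =>
    obtain ⟨B₀, hc, ho, h₀⟩ := h
    refine ⟨B₀, hc, ho, fun B hB hle => ?_⟩
    have h (x : Matrix (Fin n) (Fin n) F) : cellIntegrand ψ₀ l (a • f) x =
        a * cellIntegrand ψ₀ l f x := by
      simp [cellIntegrand, mul_left_comm]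
    rw [integral_congr_ae (Eventually.of_forall h), integral_const_mul, h₀ B hB hle, mul_zero]

lemma injective_mkQ_cellMap {ψ₀ : AddChar F ℂ} (hψ₀ : IsLocallyConstant ψ₀) (hσ : IsSmoothRep σ)
    (hKo : IsOpen (K : Set (Matrix (Fin n) (Fin n) F)))
    (hKc : IsCompact (K : Set (Matrix (Fin n) (Fin n) F)))
    (hKψ : ∀ x ∈ K, ψ₀ x.trace = 1) :
    Function.Injective ((twistedKernel (compactInd (stdParabolic F n n) σ) (unipRadical F n)
      (unipChar n ψ₀)).mkQ ∘ₗ cellMap hσ hKo hKc) := by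
  classical
  rw [injective_iff_map_eq_zero]
  intro v hv
  rw [LinearMap.comp_apply, Submodule.mkQ_apply, Submodule.Quotient.mk_eq_zero] at hv
  -- Linear forms separate points, so no topology on the representation space is needed.
  rw [← Module.forall_dual_apply_eq_zero_iff ℂ]
  intro l
  borelize (Matrix (Fin n) (Fin n) F)
  obtain ⟨B₀, hc, ho, h₀⟩ := exists_setIntegral_eq_zero_of_mem_twistedKernel
    (addHaar : Measure (Matrix (Fin n) (Fin n) F)) hψ₀ l hv
  -- This domain is large enough for the integral to vanish and contains `K`, so the same integral
  -- is also `vol(K) ℓ(v)`.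
  have h := h₀ (B₀ ⊔ K) (isCompact_sup_addSubgroup hc hKc) le_sup_left
  have hfun (x : Matrix (Fin n) (Fin n) F) : cellIntegrand ψ₀ l (cellMap hσ hKo hKc v) x =
      (K : Set (Matrix (Fin n) (Fin n) F)).indicator (fun _ => l v) x := by
    have hx : (cellMap hσ hKo hKc v).val (blockSwap n F * unip x) = if x ∈ K then v else 0 := by
      have := cellFun_apply σ K v 1 x
      rw [Subgroup.coe_one, one_mul, map_one, Module.End.one_apply] at this
      exact this
    rw [cellIntegrand, hx, Set.indicator_apply]
    by_cases hxK : x ∈ K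
    · rw [AddChar.map_neg_eq_inv, hKψ x hxK]
      simp [hxK]
    · simp [hxK]
  rw [integral_congr_ae (Eventually.of_forall hfun), setIntegral_indicator hKo.measurableSet,
    Set.inter_eq_right.mpr (SetLike.coe_subset_coe.mpr le_sup_right), setIntegral_const,
    smul_eq_zero] at h
  refine h.resolve_left ?_
  exact ENNReal.toReal_ne_zero.mpr ⟨(hKo.measure_pos addHaar ⟨0, K.zero_mem⟩).ne', hKc.measure_ne_top⟩

end Jacquet

/-! ### Equivariance under the diagonal subgroup -/

section Equivariance

variable {F : Type*} [Field F] {n : ℕ}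

/-- The diagonal embedding of `G_n` into the parabolic subgroup `P_{n,n}`. -/
def diagParabolic (n : ℕ) (F : Type*) [Field F] : GL (Fin n) F →* stdParabolic F n n :=
  (diagEmb F n).codRestrict (stdParabolic F n n) fun g => by
    change (Matrix.fromBlocks g.val 0 0 g.val).toBlocks₂₁ = 0
    rw [Matrix.toBlocks_fromBlocks₂₁]

lemma diagParabolic_diagGL_const_mem_center (a : Fˣ) :
    diagParabolic n F (diagGL n F fun _ => a) ∈ Subgroup.center (stdParabolic F n n) := by
  have h : diagEmb F n (diagGL n F fun _ => a) ∈
      Subgroup.center (GL (Fin n ⊕ Fin n) F) := by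
    rw [Subgroup.mem_center_iff]
    intro g
    have hd : (diagEmb F n (diagGL n F fun _ => a)).val = (a : F) • 1 := by
      change Matrix.fromBlocks (diagGL n F fun _ => a).val 0 0 (diagGL n F fun _ => a).val = _
      rw [diagGL_val, ← Matrix.fromBlocks_one, Matrix.fromBlocks_smul, smul_zero,
        ← Matrix.smul_one_eq_diagonal]
    ext1
    rw [Units.val_mul, Units.val_mul, hd]
    simp
  rw [Subgroup.mem_center_iff] at h ⊢
  exact fun p => Subtype.ext (h p.val)

lemma conjLattice_of_eq_scalar {g : GL (Fin n) F} (K : AddSubgroup (Matrix (Fin n) (Fin n) F))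
    {a : Fˣ} (hg : g = diagGL n F fun _ => a) : conjLattice g K = K := by
  ext x
  have h : x * g.val = g.val * x := by
    rw [hg, diagGL_val, ← Matrix.smul_one_eq_diagonal]
    simp
  change (g⁻¹).val * x * g.val ∈ K ↔ x ∈ K
  rw [mul_assoc, h, ← mul_assoc, ← Units.val_mul, inv_mul_cancel, Units.val_one, one_mul]

variable [TopologicalSpace F] [IsFiniteOrLocalField F]

/-- As `Δ(g)` commutes with `w`, one has `p w u(x) Δ(g) = p Δ(g) w u(g⁻¹ x g)`, and `g⁻¹ x g ∈ K`
means `x ∈ g K g⁻¹`. -/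
lemma compactInd_diagEmb_cellMap {W : Type*} [AddCommGroup W] [Module ℂ W]
    {σ : Representation ℂ (stdParabolic F n n) W}
    {K : AddSubgroup (Matrix (Fin n) (Fin n) F)} (hσ : IsSmoothRep σ)
    (hKo : IsOpen (K : Set (Matrix (Fin n) (Fin n) F)))
    (hKc : IsCompact (K : Set (Matrix (Fin n) (Fin n) F))) (g : GL (Fin n) F) (v : W) :
    compactInd (stdParabolic F n n) σ (diagEmb F n g) (cellMap hσ hKo hKc v) =
      cellMap hσ (isOpen_conjLattice g hKo) (isCompact_conjLattice g hKc)
        (σ (diagParabolic n F g) v) := by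
  classical
  have hmul (g : GL (Fin n) F) (p : stdParabolic F n n) (x : Matrix (Fin n) (Fin n) F) :
      p.val * (blockSwap n F * unip x) * diagEmb F n g =
        (p * diagParabolic n F g).val * (blockSwap n F * unip ((g⁻¹).val * x * g.val)) := by
    change _ = (p.val * diagEmb F n g) * _
    rw [mul_assoc, mul_assoc, unip_mul_diagEmb, ← mul_assoc (blockSwap n F),
      blockSwap_mul_diagEmb]
    simp only [mul_assoc]
  ext y
  rw [compactInd_apply]
  change cellFun σ K v (y * _) = cellFun σ (conjLattice g K) _ y
  induction y using openCell_cases with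
  | h₁ p x =>
    rw [hmul, cellFun_apply, cellFun_apply, map_mul]
    rfl
  | h₂ y hy =>
    rw [cellFun_of_forall_ne σ _ _ hy, cellFun_of_forall_ne]
    intro p x h
    refine hy (p * diagParabolic n F g⁻¹) ((g⁻¹)⁻¹.val * x * (g⁻¹).val) ?_
    rw [← hmul, ← h, map_inv, mul_inv_cancel_right]

variable {V₁ V₂ : Type*} [AddCommGroup V₁] [Module ℂ V₁] [AddCommGroup V₂] [Module ℂ V₂]
  {ρ₁ : Representation ℂ (GL (Fin n) F) V₁} {ρ₂ : Representation ℂ (GL (Fin n) F) V₂}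

lemma normalizedInflation_diagParabolic (g : GL (Fin n) F) (v : V₁ ⊗[ℂ] V₂) :
    normalizedInflation ρ₁ ρ₂ (diagParabolic n F g) v =
      ((Real.sqrt (modularCharacter (diagParabolic n F g) : ℝ) : ℝ) : ℂ) •
        ρ₁.tprod ρ₂ g v := by
  have h₁ : leviFst n n (diagParabolic n F g) = g := Units.ext rfl
  have h₂ : leviSnd n n (diagParabolic n F g) = g := Units.ext rfl
  change ((_ : ℂ) • TensorProduct.map (ρ₁ (leviFst n n (diagParabolic n F g)))
    (ρ₂ (leviSnd n n (diagParabolic n F g)))) v = _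
  rw [h₁, h₂]
  rfl

/-- The scalar by which `Δ(g)` fails to commute with `v ↦ [cellFun σ K v]`, a priori. -/
noncomputable def cellFactor (K : AddSubgroup (Matrix (Fin n) (Fin n) F)) (g : GL (Fin n) F) : ℝ :=
  Real.sqrt (modularCharacter (diagParabolic n F g) : ℝ) *
    (((K ⊓ conjLattice g K).relIndex (conjLattice g K) : ℝ) / (K ⊓ conjLattice g K).relIndex K)

variable {K : AddSubgroup (Matrix (Fin n) (Fin n) F)}

lemma cellFactor_pos (hKo : IsOpen (K : Set (Matrix (Fin n) (Fin n) F)))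
    (hKc : IsCompact (K : Set (Matrix (Fin n) (Fin n) F))) (g : GL (Fin n) F) :
    0 < cellFactor K g := by
  have hL : IsOpen ((K ⊓ conjLattice g K : AddSubgroup _) : Set (Matrix (Fin n) (Fin n) F)) :=
    hKo.inter (isOpen_conjLattice g hKo)
  have h₁ := relIndex_pos (isCompact_conjLattice g hKc) hL
  have h₂ := relIndex_pos hKc hL
  have h₃ : 0 < (modularCharacter (diagParabolic n F g) : ℝ) :=
    NNReal.coe_pos.mpr (modularCharacterFun_pos _)
  unfold cellFactor
  positivity

lemma cellFactor_scalar (hKo : IsOpen (K : Set (Matrix (Fin n) (Fin n) F)))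
    (hKc : IsCompact (K : Set (Matrix (Fin n) (Fin n) F))) (a : Fˣ) :
    cellFactor K (diagGL n F fun _ => a) = 1 := by
  have h := relIndex_pos hKc hKo
  rw [cellFactor, modularCharacter_eq_one_of_mem_center (diagParabolic_diagGL_const_mem_center a),
    conjLattice_of_eq_scalar K rfl, inf_idem, div_self (by exact_mod_cast h.ne')]
  simp

variable {ψ₀ : AddChar F ℂ} (hσ : IsSmoothRep (normalizedInflation ρ₁ ρ₂))
  (hKo : IsOpen (K : Set (Matrix (Fin n) (Fin n) F)))
  (hKc : IsCompact (K : Set (Matrix (Fin n) (Fin n) F)))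

variable (ψ₀) in
/-- The map `ρ₁ ⊗ ρ₂ → (ρ₁ × ρ₂)_{N,ψ}`, `v ↦ [cellFun σ K v]`. -/
noncomputable def cellJacquet : V₁ ⊗[ℂ] V₂ →ₗ[ℂ]
    (compactIndSpace (stdParabolic F n n) (normalizedInflation ρ₁ ρ₂) ⧸
      twistedKernel (bzProduct ρ₁ ρ₂) (unipRadical F n) (unipChar n ψ₀)) :=
  (twistedKernel (bzProduct ρ₁ ρ₂) (unipRadical F n) (unipChar n ψ₀)).mkQ ∘ₗ cellMap hσ hKo hKc

/-- The trace is invariant under conjugation, so the character is trivial on `g K g⁻¹` too. Both `K`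
and `g K g⁻¹` can then be compared with their intersection; the two indices and `δ_P^{1/2}` make up
the factor. -/
lemma twistedJacquet_cellJacquet (hKψ : ∀ x ∈ K, ψ₀ x.trace = 1) (g : GL (Fin n) F)
    (v : V₁ ⊗[ℂ] V₂) :
    bzProductTwistedJacquet ψ₀ ρ₁ ρ₂ g (cellJacquet ψ₀ hσ hKo hKc v) =
      (cellFactor K g : ℂ) • cellJacquet ψ₀ hσ hKo hKc (ρ₁.tprod ρ₂ g v) := by
  have hLo : IsOpen ((K ⊓ conjLattice g K : AddSubgroup _) : Set (Matrix (Fin n) (Fin n) F)) :=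
    hKo.inter (isOpen_conjLattice g hKo)
  have hLc : IsCompact ((K ⊓ conjLattice g K : AddSubgroup _) : Set (Matrix (Fin n) (Fin n) F)) :=
    hKc.inter_right (AddSubgroup.isClosed_of_isOpen _ (isOpen_conjLattice g hKo))
  have h₁ := mkQ_cellMap_of_le ψ₀ hσ hKo hKc hLo hLc inf_le_left hKψ (ρ₁.tprod ρ₂ g v)
  have h₂ := mkQ_cellMap_of_le ψ₀ hσ (isOpen_conjLattice g hKo) (isCompact_conjLattice g hKc)
    hLo hLc inf_le_right (addChar_trace_conjLattice hKψ g) (ρ₁.tprod ρ₂ g v)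
  have h₃ : ((K ⊓ conjLattice g K).relIndex K : ℂ) ≠ 0 := by
    exact_mod_cast (relIndex_pos hKc hLo).ne'
  change (twistedKernel (compactInd (stdParabolic F n n) (normalizedInflation ρ₁ ρ₂))
      (unipRadical F n) (unipChar n ψ₀)).mkQ (compactInd (stdParabolic F n n)
        (normalizedInflation ρ₁ ρ₂) (diagEmb F n g) (cellMap hσ hKo hKc v)) =
    (cellFactor K g : ℂ) • (twistedKernel (compactInd (stdParabolic F n n)
      (normalizedInflation ρ₁ ρ₂)) (unipRadical F n) (unipChar n ψ₀)).mkQ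
        (cellMap hσ hKo hKc (ρ₁.tprod ρ₂ g v))
  rw [compactInd_diagEmb_cellMap, normalizedInflation_diagParabolic, map_smul, map_smul, h₁, h₂,
    smul_smul, smul_smul, cellFactor]
  congr 1
  push_cast
  field_simp

lemma injective_cellJacquet (hψ₀ : IsLocallyConstant ψ₀) (hKψ : ∀ x ∈ K, ψ₀ x.trace = 1) :
    Function.Injective (cellJacquet ψ₀ hσ hKo hKc) :=
  injective_mkQ_cellMap hψ₀ hσ hKo hKc hKψ

lemma cellFactor_eq_one [Nontrivial (V₁ ⊗[ℂ] V₂)]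
    (hinj : Function.Injective (cellJacquet ψ₀ hσ hKo hKc)) (hKψ : ∀ x ∈ K, ψ₀ x.trace = 1) (g : GL (Fin n) F) :
    cellFactor K g = 1 := by
  obtain ⟨w, hw⟩ := exists_ne (0 : V₁ ⊗[ℂ] V₂)
  have hmul (g h : GL (Fin n) F) : cellFactor K (g * h) = cellFactor K g * cellFactor K h := by
    -- With this vector, acting by `g * h` at once or by `h` and then `g` gives two multiples of the
    -- class of `w`, which is non-zero by injectivity.
    have h₁ := twistedJacquet_cellJacquet hσ hKo hKc hKψ (g * h) (ρ₁.tprod ρ₂ (g * h)⁻¹ w)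
    rw [map_mul (bzProductTwistedJacquet ψ₀ ρ₁ ρ₂), Module.End.mul_apply,
      twistedJacquet_cellJacquet hσ hKo hKc hKψ, map_smul,
      twistedJacquet_cellJacquet hσ hKo hKc hKψ, ← Module.End.mul_apply (ρ₁.tprod ρ₂ g),
      ← map_mul, ← Module.End.mul_apply, ← map_mul, mul_inv_cancel, map_one,
      Module.End.one_apply, smul_smul] at h₁
    have h₂ := smul_left_injective ℂ ((map_ne_zero_iff _ hinj).mpr hw) h₁
    rw [mul_comm]
    exact_mod_cast h₂.symm
  let χ : GL (Fin n) F →* {x : ℝ // 0 < x} :=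
    MonoidHom.mk' (fun g => ⟨cellFactor K g, cellFactor_pos hKo hKc g⟩)
      fun g h => Subtype.ext (hmul g h)
  have hχ : χ = 1 := by
    refine GL_hom_eq_one_of_scalar (fun x k hk hx => Subtype.ext ?_) χ fun a =>
      Subtype.ext (cellFactor_scalar hKo hKc a)
    exact (pow_eq_one_iff_of_nonneg x.2.le hk).mp (congrArg Subtype.val hx)
  exact congrArg Subtype.val (DFunLike.congr_fun hχ g)

end Equivariance

end

theorem theorem1p6 {F : Type*} [Field F] [TopologicalSpace F] [IsFiniteOrLocalField F]
    (n : ℕ) (ψ₀ : AddChar F ℂ) (hψ₀ : IsLocallyConstant ψ₀) (hψ₀_ne : ψ₀ ≠ 1)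
    {V₁ V₂ : Type*} [AddCommGroup V₁] [Module ℂ V₁] [AddCommGroup V₂] [Module ℂ V₂]
    (ρ₁ : Representation ℂ (GL (Fin n) F) V₁) (ρ₂ : Representation ℂ (GL (Fin n) F) V₂)
    (hρ₁ : IsSmoothRep ρ₁) (hρ₂ : IsSmoothRep ρ₂) :
    (∃ φ : Representation.IntertwiningMap (ρ₁.tprod ρ₂) (bzProductTwistedJacquet ψ₀ ρ₁ ρ₂),
      Function.Injective φ) ∧
    (Nontrivial V₁ → Nontrivial V₂ →
      Nontrivial (compactIndSpace (stdParabolic F n n) (normalizedInflation ρ₁ ρ₂) ⧸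
        twistedKernel (bzProduct ρ₁ ρ₂) (unipRadical F n) (unipChar n ψ₀))) := by
  have hσ := isSmoothRep_normalizedInflation hρ₁ hρ₂
  obtain ⟨K, hKc, hKo, hKψ⟩ := exists_isCompact_isOpen_addSubgroup_addChar hψ₀ n
  have hinj := injective_cellJacquet hσ hKo hKc hψ₀ hKψ
  refine ⟨⟨⟨cellJacquet ψ₀ hσ hKo hKc, fun g => LinearMap.ext fun v => ?_⟩, hinj⟩,
    fun _ _ => hinj.nontrivial⟩
  -- A non-zero vector is needed to show that the factor is multiplicative; if the tensor product is
  -- zero, equivariance is trivial.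
  rcases subsingleton_or_nontrivial (V₁ ⊗[ℂ] V₂) with _ | _
  · simp [Subsingleton.elim v 0]
  · have h := twistedJacquet_cellJacquet hσ hKo hKc hKψ g v
    rw [cellFactor_eq_one hσ hKo hKc hinj hKψ, Complex.ofReal_one, one_smul] at h
    exact h.symm
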